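/- **Words on trees.** A labeled rooted planar tree with $a$ edges is a tree on the label set $\{1,\dots,a+1\}$ with a distinguished vertex (the root) and a left-to-right order on the children of each vertex. An edge is called odd if its endpoint farther from the root is at odd distance from the root. A closed word with $2k$ steps on such a tree, starting from the root, is a sequence of labels $i_1,\dots,i_{2k+1}$ with $i_1=i_{2k+1}$ equal to the root and $i_j,i_{j+1}$ adjacent for all $1\le j\le 2k$; an edge $e$ is browsed $\#\{j:\{i_j,i_{j+1}\}=e\}$ times. Two words $(i_j)$, $(i'_j)$ on trees with the same number of vertices are equivalent if there is a bijection $\sigma$ of the labels with $\sigma(i_j)=i'_j$ for all $j$. For $\mathbf b=(b_1,\dots,b_a)$ let $\mathcal W_k(a,a+1,l,\mathbf b)$ be a set of representatives of the equivalence classes of closed words with $2k$ steps, starting from the root, on labeled rooted planar trees with $a$ edges, exactly $l$ of them odd, such that for some enumeration $e_1,\dots,e_a$ of the edges, $e_i$ is browsed exactly $b_i$ times for each $i$. **Theorem.** Let $\mathcal A=(A_k)_{k\ge1}$ be a sequence of real numbers such that $A_k=O(\gamma^k)$ as $k\to\infty$ for some $\gamma>0$, and let $\alpha>0$. There is a probability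 law $\mu_{\mathcal A,\alpha}$ on $\mathbb R$, depending only on $\mathcal A$ and $\alpha$, such that the following holds. For $n\ge1$ let $P_n$ be a probability law on $\mathbb R$ with finite moments $M_k(P_n)=\int x^k\,dP_n$ of all orders, $M_1(P_n)=0$ and $M_2(P_n)>0$, such that for all $k\ge1$ $$\lim_{n\to\infty}\frac{M_k(P_n)}{n^{k/2-1}M_2(P_n)^{k/2}}=A_k ;$$ let $m=m(n)$ be integers with $m/n\to\alpha$, let $X_n$ be a random $n\times m$ matrix with i.i.d. entries of law $P_n$, let $W_n=\frac1{nM_2(P_n)}X_nX_n^T$, and let $\mu_{W_n}=\frac1n\sum_{\lambda\in\mathrm{Spec}(W_n)}\delta_\lambda$ be its spectral measure (eigenvalues counted with multiplicity). Then: 1. $\mu_{W_n}$ converges weakly to $\mu_{\mathcal A,\alpha}$ in probability: for all $\varepsilon>0$ and all bounded continuous $f:\mathbb R\to\mathbb R$, $$\mathbb P\left(\left|\int f\,d\mu_{W_n}-\int f\,d\mu_{\mathcal A,\alpha}\right|>\varepsilon\right)\xrightarrow[n\to\infty]{}0 .$$ 2. $\mu_{\mathcal A,\alpha}$ has finite moments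 of all orders, and for all $k\ge1$ $$M_k(\mu_{\mathcal A,\alpha})=\sum_{a=1}^{k}\sum_{l=1}^{a}\alpha^l\sum_{\substack{b_1\ge b_2\ge\cdots\ge b_a\ge2\\ b_1+\cdots+b_a=2k}}|\mathcal W_k(a,a+1,l,\mathbf b)|\prod_{i=1}^{a}A_{b_i} .$$ 3. $\mu_{\mathcal A,\alpha}$ is characterized by these moments: it is the only probability law on $\mathbb R$ all of whose moments are finite and given by this formula. -/

import Mathlib

open MeasureTheory ProbabilityTheory Filter Topology

noncomputable section

namespace Wishart

/-! ### Random matrices -/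

/-- The `k`-th moment of a measure on the real line. -/
def mom (P : Measure ℝ) (k : ℕ) : ℝ := ∫ x, x ^ k ∂P

/-- The normalized Wishart matrix `(n v)⁻¹ X Xᵀ` of an `n × m` matrix `X`. -/
def wishart {n m : ℕ} (v : ℝ) (X : Matrix (Fin n) (Fin m) ℝ) : Matrix (Fin n) (Fin n) ℝ :=
  (1 / ((n : ℝ) * v)) • (X * X.transpose)

theorem wishart_isHermitian {n m : ℕ} (v : ℝ) (X : Matrix (Fin n) (Fin m) ℝ) :
    (wishart v X).IsHermitian := by
  unfold wishart
  rw [Matrix.IsHermitian, Matrix.conjTranspose_eq_transpose_of_trivial,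
    Matrix.transpose_smul, Matrix.transpose_mul, Matrix.transpose_transpose]

/-- The spectral measure `n⁻¹ ∑ δ_λ` of a real symmetric `n × n` matrix, the sum being over the
eigenvalues counted with multiplicity. -/
def spectralMeasure {n : ℕ} {M : Matrix (Fin n) (Fin n) ℝ} (hM : M.IsHermitian) : Measure ℝ :=
  (n : ENNReal)⁻¹ • ∑ i : Fin n, Measure.dirac (hM.eigenvalues i)

/-! ### Closed words on labeled rooted planar trees -/

/-- A rooted planar tree on the set of labels `V`: a tree with a distinguished vertex, together
with a left-to-right order on the children of every vertex. -/
structure PlanarTree (V : Type*) where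
  graph : SimpleGraph V
  isTree : graph.IsTree
  root : V
  childOrder : ∀ v : V,
    LinearOrder {w : V // graph.Adj v w ∧ graph.dist root w = graph.dist root v + 1}

/-- The odd edges of a rooted planar tree: the edges whose endpoint farther from the root is at
odd distance from the root. (In particular the edges at the root are odd.) -/
def PlanarTree.oddEdges {V : Type*} (T : PlanarTree V) : Set (Sym2 V) :=
  {e | e ∈ T.graph.edgeSet ∧ ∃ v ∈ e, Odd (T.graph.dist T.root v) ∧
    ∀ w ∈ e, T.graph.dist T.root w ≤ T.graph.dist T.root v}

/-- The number of times that the word `w` browses the edge `e` (in either direction). -/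
def browseCount {V : Type*} {N : ℕ} (w : Fin (N + 1) → V) (e : Sym2 V) : ℕ :=
  Nat.card {j : Fin N // s(w j.castSucc, w j.succ) = e}

/-- `w` is a closed word on `T` with `N` steps (hence with `N + 1` letters), starting from the
root. -/
structure IsClosedWord {V : Type*} {N : ℕ} (T : PlanarTree V) (w : Fin (N + 1) → V) : Prop where
  adj : ∀ j : Fin N, T.graph.Adj (w j.castSucc) (w j.succ)
  start : w 0 = T.root
  closed : w (Fin.last N) = w 0

/-- The numbers of times that `w` browses the edges of `T` are `b₁, …, b_a`, in some order. -/
def HasBrowseCounts {V : Type*} {N a : ℕ} (T : PlanarTree V) (w : Fin (N + 1) → V)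
    (b : Fin a → ℕ) : Prop :=
  ∃ e : Fin a ≃ T.graph.edgeSet, ∀ i, browseCount w (e i : Sym2 V) = b i

/-- Two words are equivalent if a bijection of the labels maps one to the other. -/
def wordSetoid (V : Type*) (N : ℕ) : Setoid (Fin (N + 1) → V) where
  r w w' := ∃ σ : Equiv.Perm V, ∀ j, σ (w j) = w' j
  iseqv :=
    { refl := fun _ => ⟨1, fun _ => rfl⟩
      symm := fun ⟨σ, h⟩ => ⟨σ.symm, fun j => by rw [← h j, Equiv.symm_apply_apply]⟩
      trans := fun ⟨σ, h⟩ ⟨τ, h'⟩ => ⟨σ.trans τ, fun j => by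
        rw [Equiv.trans_apply, h j, h' j]⟩ }

/-- The set of equivalence classes of closed words with `2k` steps, starting from the root, on
labeled rooted planar trees with `a` edges (and `a + 1` vertices), `l` of which are odd, whose
edges are browsed `b₁, …, b_a` times. -/
def wordClasses (k a l : ℕ) (b : Fin a → ℕ) :
    Set (Quotient (wordSetoid (Fin (a + 1)) (2 * k))) :=
  {c | ∃ (T : PlanarTree (Fin (a + 1))) (w : Fin (2 * k + 1) → Fin (a + 1)),
    IsClosedWord T w ∧ T.oddEdges.ncard = l ∧ HasBrowseCounts T w b ∧
    c = Quotient.mk (wordSetoid (Fin (a + 1)) (2 * k)) w}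

open Classical in
/-- The `a`-tuples `b₁ ≥ b₂ ≥ ⋯ ≥ b_a ≥ 2` of integers with sum `2k`. -/
def multiplicities (a k : ℕ) : Finset (Fin a → ℕ) :=
  {b ∈ (Finset.univ : Finset (Fin a)).piAntidiag (2 * k) | Antitone b ∧ ∀ i, 2 ≤ b i}

/-- The right-hand side of the moment formula (for `k ≥ 1`). -/
def limitMoment (A : ℕ → ℝ) (α : ℝ) (k : ℕ) : ℝ :=
  ∑ a ∈ Finset.Icc 1 k, ∑ l ∈ Finset.Icc 1 a, α ^ l *
    ∑ b ∈ multiplicities a k, ((wordClasses k a l b).ncard : ℝ) * ∏ i : Fin a, A (b i)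

end Wishart

end

/-! The proof is the method of moments. The moment of order `K + 1` of the spectral measure is a
normalized trace, hence a sum over closed alternating words `x₀ y₀ ⋯ x_K y_K x₀` of row and column
indices. The expectation of the term of a word depends only on which positions carry equal letters,
that is, on a pair of kernels `(π, ρ)`, set partitions of the row positions and of the column
positions. The words with given kernels are counted by two falling factorials, of total order `n ^
(p + q)` for `p` row and `q` column classes, while the normalization of the moments of `P n`
contributes `n ^ (-(a + 1))`, where `a` is the number of distinct steps
(`integral_mom_eq_sum_kernels`). The graph of the word is connected, so `p + q ≤ a + 1`, with
equality exactly for trees; in the limit only trees survive, each with weight `α ^ q` times a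
product of the `A b` (`kernelSum`).

The variance is a sum over pairs of words. If the two words share no edge, independence makes their
covariance vanish; otherwise their union is connected, which costs one power of `n`
(`tendsto_kernelCov`). By Chebyshev the moments converge in probability.

The sum over tree kernels is the right-hand side of the moment formula: the kernels of a word are a
complete invariant of its equivalence class (`ncard_wordClasses`), column classes are the vertices
at odd distance from the root, and an edge browsed once contributes `A 1 = 0`
(`kernelSum_eq_limitMoment`).

A word on a tree is determined by its first letter, the set of its steps away from the root and
their targets. This bounds the number of contributing kernels, and thus the limit moment of order
`k` by a constant times `B ^ k * k!` for some `B` (`factorialBound_limitMoment`). Such moments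
determine a law, since its complex moment generating function is analytic in a strip
(`eq_of_hasMoments`). Existence of the law comes from tightness, applied to spectral measures of
well-chosen outcomes (`exists_hasMoments`), and weak convergence from compactness
(`exists_forall_abs_integral_sub_lt`). -/

noncomputable section

namespace Wishart

/-! ### The method of moments -/

/-- The law `ν` has finite moments of all orders `k ≥ 1`, and they are given by `c`. -/
def HasMoments (ν : Measure ℝ) (c : ℕ → ℝ) : Prop :=
  ∀ k : ℕ, 1 ≤ k → Integrable (fun x : ℝ => x ^ k) ν ∧ mom ν k = c k

/-- A factorial bound on a sequence of moments. -/
def FactorialBound (c : ℕ → ℝ) : Prop :=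
  ∃ C K : ℝ, 1 ≤ C ∧ 0 < K ∧ ∀ k : ℕ, 1 ≤ k → |c k| ≤ C * K ^ k * k.factorial

/-- The Taylor series of `cosh` has only even powers, so its terms are nonnegative and may be
integrated one by one. The factorials cancel, leaving a geometric series of ratio `(|t| * K) ^ 2`.
-/
theorem integrable_cosh_of_factorialBound {ν : Measure ℝ} [IsProbabilityMeasure ν] {c : ℕ → ℝ}
    {C K t : ℝ} (hC : 1 ≤ C) (hK : 0 < K)
    (hb : ∀ k : ℕ, 1 ≤ k → |c k| ≤ C * K ^ k * k.factorial) (hν : HasMoments ν c)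
    (ht : |t| * K < 1) : Integrable (fun x : ℝ => Real.cosh (t * x)) ν := by
  refine ⟨by fun_prop, ?_⟩
  rw [hasFiniteIntegral_iff_ofReal (ae_of_all _ fun x => (Real.cosh_pos _).le)]
  have hs : ∀ x : ℝ, ENNReal.ofReal (Real.cosh (t * x)) =
      ∑' j : ℕ, ENNReal.ofReal ((t * x) ^ (2 * j) / (2 * j).factorial) := by
    intro x
    have h := Real.hasSum_cosh (t * x)
    rw [← h.tsum_eq, ENNReal.ofReal_tsum_of_nonneg _ h.summable]
    intro j
    have : 0 ≤ (t * x) ^ (2 * j) := (even_two_mul j).pow_nonneg _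
    positivity
  simp_rw [hs]
  rw [lintegral_tsum (fun j => by fun_prop)]
  have hle : ∀ j : ℕ, ∫⁻ x, ENNReal.ofReal ((t * x) ^ (2 * j) / (2 * j).factorial) ∂ν ≤
      ENNReal.ofReal (C * ((|t| * K) ^ 2) ^ j) := by
    intro j
    -- The hypotheses say nothing about `c 0`; the term of order zero is `1`, which is where `1 ≤ C`
    -- enters.
    rcases Nat.eq_zero_or_pos j with rfl | hj
    · simpa using hC
    have hint : Integrable (fun x : ℝ => (t * x) ^ (2 * j) / (2 * j).factorial) ν := by
      have := ((hν (2 * j) (by omega)).1.const_mul (t ^ (2 * j))).div_const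
        ((2 * j).factorial : ℝ)
      refine this.congr (ae_of_all _ fun x => ?_)
      simp [mul_pow]
    rw [← ofReal_integral_eq_lintegral_ofReal hint (ae_of_all _ fun x => by
      have : 0 ≤ (t * x) ^ (2 * j) := (even_two_mul j).pow_nonneg _
      simp only [Pi.zero_apply]
      positivity)]
    apply ENNReal.ofReal_le_ofReal
    have h1 : ∫ x, (t * x) ^ (2 * j) / (2 * j).factorial ∂ν =
        t ^ (2 * j) * c (2 * j) / (2 * j).factorial := by
      rw [← (hν (2 * j) (by omega)).2, mom, ← integral_const_mul, ← integral_div]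
      simp [mul_pow]
    rw [h1, div_le_iff₀ (by positivity)]
    have h2 := (le_abs_self _).trans (hb (2 * j) (by omega))
    have h3 : t ^ (2 * j) = |t| ^ (2 * j) := by rw [pow_mul, pow_mul, sq_abs]
    calc t ^ (2 * j) * c (2 * j) ≤ |t| ^ (2 * j) * (C * K ^ (2 * j) * (2 * j).factorial) := by
          rw [h3]; gcongr
      _ = _ := by rw [← pow_mul, mul_pow]; ring
  refine (ENNReal.tsum_le_tsum hle).trans_lt ?_
  rw [← ENNReal.ofReal_tsum_of_nonneg (fun j => by positivity)]
  · exact ENNReal.ofReal_lt_top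
  · refine (summable_geometric_of_lt_one (by positivity) ?_).mul_left C
    have : 0 ≤ |t| * K := by positivity
    nlinarith

theorem mem_integrableExpSet_of_factorialBound {ν : Measure ℝ} [IsProbabilityMeasure ν]
    {c : ℕ → ℝ} {C K : ℝ} (hC : 1 ≤ C) (hK : 0 < K)
    (hb : ∀ k : ℕ, 1 ≤ k → |c k| ≤ C * K ^ k * k.factorial) (hν : HasMoments ν c) :
    Set.Ioo (-K⁻¹) K⁻¹ ⊆ interior (integrableExpSet id ν) := by
  refine interior_maximal ?_ isOpen_Ioo
  intro t ht
  have ht' : |t| * K < 1 := by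
    rw [← lt_div_iff₀ hK, one_div]
    exact abs_lt.2 ht
  have h := (integrable_cosh_of_factorialBound hC hK hb hν ht').const_mul 2
  refine Integrable.mono' h (by fun_prop) (ae_of_all _ fun x => ?_)
  simp only [id, Real.norm_eq_abs, Real.abs_exp, Real.cosh_eq]
  have := Real.exp_pos (-(t * x))
  linarith

/-- A probability law is determined by its moments as soon as they satisfy a factorial bound. -/
theorem eq_of_hasMoments {c : ℕ → ℝ} (hc : FactorialBound c) {μ ν : Measure ℝ}
    [IsProbabilityMeasure μ] [IsProbabilityMeasure ν] (hμ : HasMoments μ c)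
    (hν : HasMoments ν c) : μ = ν := by
  obtain ⟨C, K, hC, hK, hb⟩ := hc
  set U : Set ℂ := {z : ℂ | z.re ∈ Set.Ioo (-K⁻¹) K⁻¹} with hU
  have key : ∀ {ρ : Measure ℝ} [IsProbabilityMeasure ρ], HasMoments ρ c →
      AnalyticOnNhd ℂ (complexMGF id ρ) U := fun hρ z hz =>
    analyticAt_complexMGF (mem_integrableExpSet_of_factorialBound hC hK hb hρ hz)
  have h0 : (0 : ℂ) ∈ U := by simp [hU, hK]
  -- The derivatives at `0` are the moments, so the two generating functions have the same Taylor
  -- series there.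
  have hder : ∀ {ρ : Measure ℝ} [IsProbabilityMeasure ρ], HasMoments ρ c → ∀ n : ℕ,
      iteratedDeriv n (complexMGF id ρ) 0 = if n = 0 then 1 else (c n : ℂ) := by
    intro ρ _ hρ n
    rw [iteratedDeriv_complexMGF (mem_integrableExpSet_of_factorialBound hC hK hb hρ h0)]
    split_ifs with hn
    · simp [hn]
    · rw [← (hρ n (by omega)).2, mom, ← integral_complex_ofReal]
      simp
  have hev : complexMGF id μ =ᶠ[𝓝 0] complexMGF id ν := by
    have h1 := (key hμ 0 h0).hasFPowerSeriesAt
    have h2 := (key hν 0 h0).hasFPowerSeriesAt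
    simp_rw [hder hμ] at h1
    simp_rw [hder hν] at h2
    filter_upwards [h1.eventually_hasSum_sub, h2.eventually_hasSum_sub] with z hz1 hz2
    exact hz1.unique hz2
  -- Identity theorem on a vertical strip, which contains the imaginary axis, where `complexMGF` is
  -- the characteristic function.
  have heq : Set.EqOn (complexMGF id μ) (complexMGF id ν) U :=
    (key hμ).eqOn_of_preconnected_of_eventuallyEq (key hν)
      ((convex_Ioo _ _).linear_preimage Complex.reLm).isPreconnected h0 hev
  apply Measure.ext_of_charFun
  ext t
  rw [← complexMGF_id_mul_I, ← complexMGF_id_mul_I]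
  exact heq (by simp [hU, hK])

/-! ### Tightness, and moments under weak convergence. -/

theorem isTightMeasureSet_of_mom_two_le {S : Set (Measure ℝ)} {B : ℝ}
    (hint : ∀ ν ∈ S, Integrable (fun x : ℝ => x ^ 2) ν) (hB : ∀ ν ∈ S, mom ν 2 ≤ B) :
    IsTightMeasureSet S := by
  refine isTightMeasureSet_of_tendsto_measure_norm_gt ?_
  have hlim : Tendsto (fun r : ℝ => ENNReal.ofReal (B / r ^ 2)) atTop (𝓝 0) := by
    rw [← ENNReal.ofReal_zero]
    refine (ENNReal.continuous_ofReal.tendsto 0).comp ?_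
    exact tendsto_const_nhds.div_atTop (tendsto_pow_atTop two_ne_zero)
  refine tendsto_of_tendsto_of_tendsto_of_le_of_le' tendsto_const_nhds hlim
    (Eventually.of_forall fun _ => zero_le) ?_
  filter_upwards [eventually_gt_atTop 0] with r hr
  refine iSup₂_le fun ν hν => ?_
  have hr2 : ENNReal.ofReal (r ^ 2) ≠ 0 := by
    rw [ne_eq, ENNReal.ofReal_eq_zero, not_le]; positivity
  have hsub : {x : ℝ | r < ‖x‖} ⊆ {x : ℝ | ENNReal.ofReal (r ^ 2) ≤ ENNReal.ofReal (x ^ 2)} := by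
    intro x hx
    apply ENNReal.ofReal_le_ofReal
    rw [← sq_abs x]
    have : r < |x| := hx
    gcongr
  refine (measure_mono hsub).trans ?_
  refine (meas_ge_le_lintegral_div (by fun_prop) hr2 ENNReal.ofReal_ne_top).trans ?_
  rw [← ofReal_integral_eq_lintegral_ofReal (hint ν hν) (ae_of_all _ fun x => sq_nonneg x),
    ← ENNReal.ofReal_div_of_pos (by positivity)]
  apply ENNReal.ofReal_le_ofReal
  have := hB ν hν
  rw [mom] at this
  gcongr

/-- The truncation of a power to a bounded interval, as a bounded continuous function. -/
def truncPow (k : ℕ) (R : ℝ) : BoundedContinuousFunction ℝ ℝ :=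
  BoundedContinuousFunction.ofNormedAddCommGroup (fun x : ℝ => (max (-R) (min x R)) ^ k)
    (by fun_prop) (|R| ^ k) (fun x => by
      rw [norm_pow, Real.norm_eq_abs]
      refine pow_le_pow_left₀ (abs_nonneg _) ?_ k
      rcases le_total 0 R with h | h
      · rw [abs_of_nonneg h, abs_le]
        exact ⟨le_max_left _ _, max_le (by linarith) (min_le_right _ _)⟩
      · rw [abs_of_nonpos h, abs_le, neg_neg]
        exact ⟨le_max_of_le_left (by linarith),
          max_le le_rfl ((min_le_right _ _).trans (by linarith))⟩)

/-- Outside `[-R, R]` both powers are at most `|x| ^ k` in absolute value, and `1 ≤ |x| ^ k / R ^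
k`. The truncation error is thus controlled by the moment of order `2 * k`. -/
theorem abs_pow_sub_truncPow_le (k : ℕ) {R : ℝ} (hR : 0 < R) (x : ℝ) :
    |x ^ k - truncPow k R x| ≤ 2 / R ^ k * x ^ (2 * k) := by
  change |x ^ k - (max (-R) (min x R)) ^ k| ≤ _
  have hx2 : x ^ (2 * k) = |x| ^ k * |x| ^ k := by rw [pow_mul, ← sq_abs, ← pow_mul]; ring
  by_cases hx : |x| ≤ R
  · obtain ⟨h1, h2⟩ := abs_le.1 hx
    rw [min_eq_left h2, max_eq_right h1, sub_self, abs_zero, hx2]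
    positivity
  · rw [not_le] at hx
    have hm : |max (-R) (min x R)| ≤ |x| := by
      refine le_trans ?_ hx.le
      rw [abs_le]
      exact ⟨le_max_left _ _, max_le (by linarith) (min_le_right _ _)⟩
    calc |x ^ k - (max (-R) (min x R)) ^ k| ≤ |x ^ k| + |(max (-R) (min x R)) ^ k| := abs_sub _ _
      _ ≤ |x| ^ k + |x| ^ k := by rw [abs_pow, abs_pow]; gcongr
      _ = 2 * |x| ^ k * 1 := by ring
      _ ≤ 2 * |x| ^ k * (|x| ^ k / R ^ k) := by
          gcongr
          rw [one_le_div (by positivity)]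
          gcongr
      _ = _ := by rw [hx2]; ring

/-- Fatou's lemma along a weak limit, through the portmanteau inequality for open sets. -/
theorem integrable_pow_of_tendsto {ν : ℕ → ProbabilityMeasure ℝ} {μ : ProbabilityMeasure ℝ}
    (hν : Tendsto ν atTop (𝓝 μ)) {k : ℕ} {B : ℝ}
    (hint : ∀ j, Integrable (fun x : ℝ => x ^ (2 * k)) (ν j : Measure ℝ))
    (hB : ∀ j, mom (ν j) (2 * k) ≤ B) :
    Integrable (fun x : ℝ => x ^ (2 * k)) (μ : Measure ℝ) := by
  have hnn : ∀ x : ℝ, 0 ≤ x ^ (2 * k) := fun x => (even_two_mul k).pow_nonneg x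
  refine ⟨by fun_prop, ?_⟩
  rw [hasFiniteIntegral_iff_ofReal (ae_of_all _ hnn)]
  have h := lintegral_le_liminf_lintegral_of_forall_isOpen_measure_le_liminf_measure
    (μ := (μ : Measure ℝ)) (μs := fun j => (ν j : Measure ℝ)) (f := fun x : ℝ => x ^ (2 * k))
    (by fun_prop) hnn (fun G hG => ProbabilityMeasure.le_liminf_measure_open_of_tendsto hν hG)
  refine (h.trans (liminf_le_of_le (by isBoundedDefault)
    (a := ENNReal.ofReal B) fun b hb => ?_)).trans_lt ENNReal.ofReal_lt_top
  obtain ⟨j, hj⟩ := hb.exists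
  refine hj.trans ?_
  rw [← ofReal_integral_eq_lintegral_ofReal (hint j) (ae_of_all _ hnn)]
  exact ENNReal.ofReal_le_ofReal (hB j)

theorem integrable_pow_of_two_mul {ν : Measure ℝ} [IsFiniteMeasure ν] {k : ℕ}
    (h : Integrable (fun x : ℝ => x ^ (2 * k)) ν) : Integrable (fun x : ℝ => x ^ k) ν := by
  refine Integrable.mono' (h.add (integrable_const 1)) (by fun_prop) (ae_of_all _ fun x => ?_)
  simp only [Pi.add_apply, Real.norm_eq_abs]
  rw [mul_comm 2 k, pow_mul]
  nlinarith [sq_nonneg (|x ^ k| - 1), sq_abs (x ^ k), abs_nonneg (x ^ k)]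

theorem abs_mom_sub_integral_truncPow_le {ν : Measure ℝ} [IsProbabilityMeasure ν] {k : ℕ}
    (h : Integrable (fun x : ℝ => x ^ (2 * k)) ν) {R B : ℝ} (hR : 0 < R)
    (hB : mom ν (2 * k) ≤ B) :
    |mom ν k - ∫ x, truncPow k R x ∂ν| ≤ 2 / R ^ k * B := by
  rw [mom, ← integral_sub (integrable_pow_of_two_mul h) ((truncPow k R).integrable ν)]
  refine abs_integral_le_integral_abs.trans ?_
  refine (integral_mono_of_nonneg (ae_of_all _ fun x => abs_nonneg _) (h.const_mul _)
    (ae_of_all _ fun x => abs_pow_sub_truncPow_le k hR x)).trans ?_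
  rw [integral_const_mul]
  rw [mom] at hB
  gcongr

/-- Bounded moments of order `2 * k` make the truncation error of `x ^ k` uniformly small, and the
truncated power is a test function for weak convergence: an `ε / 3` argument. -/
theorem tendsto_mom_of_tendsto {ν : ℕ → ProbabilityMeasure ℝ} {μ : ProbabilityMeasure ℝ}
    (hν : Tendsto ν atTop (𝓝 μ)) {k : ℕ} (hk : 1 ≤ k) {B : ℝ}
    (hint : ∀ j, Integrable (fun x : ℝ => x ^ (2 * k)) (ν j : Measure ℝ))
    (hB : ∀ j, mom (ν j) (2 * k) ≤ B) :
    Tendsto (fun j => mom (ν j) k) atTop (𝓝 (mom μ k)) := by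
  have hμ := integrable_pow_of_tendsto hν hint hB
  set B' := max 1 (max B (mom μ (2 * k))) with hB'
  have hB'0 : 0 < B' := lt_of_lt_of_le one_pos (le_max_left _ _)
  rw [Metric.tendsto_atTop]
  intro ε hε
  obtain ⟨R, hR, hRε⟩ : ∃ R : ℝ, 0 < R ∧ 2 / R ^ k * B' < ε / 3 := by
    have : Tendsto (fun R : ℝ => 2 / R ^ k * B') atTop (𝓝 (0 * B')) :=
      (tendsto_const_nhds.div_atTop (tendsto_pow_atTop (by omega))).mul_const _
    rw [zero_mul] at this
    obtain ⟨R, h1, h2⟩ := ((this.eventually_lt_const (by positivity : 0 < ε / 3)).and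
      (eventually_gt_atTop 0)).exists
    exact ⟨R, h2, h1⟩
  have hf := (ProbabilityMeasure.tendsto_iff_forall_integral_tendsto.1 hν) (truncPow k R)
  obtain ⟨N, hN⟩ := (Metric.tendsto_atTop.1 hf) (ε / 3) (by positivity)
  refine ⟨N, fun j hj => ?_⟩
  have h1 := abs_mom_sub_integral_truncPow_le (hint j) hR (B := B')
    ((hB j).trans ((le_max_left _ _).trans (le_max_right 1 _)))
  have h2 := abs_mom_sub_integral_truncPow_le hμ hR (B := B')
    ((le_max_right _ _).trans (le_max_right 1 _))
  have h3 := hN j hj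
  rw [Real.dist_eq] at h3 ⊢
  rw [abs_le] at h1 h2
  rw [abs_lt] at h3 ⊢
  constructor <;> linarith [h1.1, h1.2, h2.1, h2.2, h3.1, h3.2]

/-- Laws whose moments converge have a subsequence that converges weakly, and the limit has the
limiting moments. -/
theorem exists_subseq_tendsto_of_tendsto_mom {ν : ℕ → ProbabilityMeasure ℝ} {c : ℕ → ℝ}
    (hint : ∀ j (k : ℕ), Integrable (fun x : ℝ => x ^ k) (ν j : Measure ℝ))
    (hlim : ∀ k : ℕ, 1 ≤ k → Tendsto (fun j => mom (ν j) k) atTop (𝓝 (c k))) :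
    ∃ (φ : ℕ → ℕ) (μ : ProbabilityMeasure ℝ), StrictMono φ ∧ Tendsto (ν ∘ φ) atTop (𝓝 μ) ∧
      HasMoments μ c := by
  have hbdd : ∀ k : ℕ, 1 ≤ k → ∃ B : ℝ, ∀ j, mom (ν j) k ≤ B := fun k hk => by
    obtain ⟨B, hB⟩ := (hlim k hk).bddAbove_range
    exact ⟨B, fun j => hB ⟨j, rfl⟩⟩
  obtain ⟨B, hB⟩ := hbdd 2 one_le_two
  have htight : IsTightMeasureSet
      {((ρ : ProbabilityMeasure ℝ) : Measure ℝ) | ρ ∈ Set.range ν} := by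
    apply isTightMeasureSet_of_mom_two_le (B := B)
    · rintro _ ⟨_, ⟨j, rfl⟩, rfl⟩
      exact hint j 2
    · rintro _ ⟨_, ⟨j, rfl⟩, rfl⟩
      exact hB j
  obtain ⟨μ, -, φ, hφ, hμ⟩ := (isCompact_closure_of_isTightMeasureSet htight).tendsto_subseq
    (x := ν) (fun j => subset_closure ⟨j, rfl⟩)
  refine ⟨φ, μ, hφ, hμ, fun k hk => ?_⟩
  obtain ⟨D, hD⟩ := hbdd (2 * k) (by omega)
  refine ⟨integrable_pow_of_two_mul
    (integrable_pow_of_tendsto hμ (fun j => hint (φ j) _) (fun j => hD (φ j))), ?_⟩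
  exact tendsto_nhds_unique
    (tendsto_mom_of_tendsto hμ hk (fun j => hint (φ j) _) (fun j => hD (φ j)))
    ((hlim k hk).comp hφ.tendsto_atTop)

/-- Laws that have, for every `N`, their first `N` moments `1 / (N + 1)`-close to `c`. -/
theorem tendsto_mom_of_abs_sub_lt {ν : ℕ → ProbabilityMeasure ℝ} {c : ℕ → ℝ}
    (h : ∀ N k : ℕ, 1 ≤ k → k ≤ N → |mom (ν N) k - c k| < 1 / ((N : ℝ) + 1)) (k : ℕ)
    (hk : 1 ≤ k) : Tendsto (fun N => mom (ν N) k) atTop (𝓝 (c k)) := by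
  rw [tendsto_iff_dist_tendsto_zero]
  refine squeeze_zero' (Eventually.of_forall fun _ => dist_nonneg) ?_
    tendsto_one_div_add_atTop_nhds_zero_nat
  filter_upwards [eventually_ge_atTop k] with N hN
  rw [Real.dist_eq]
  exact (h N k hk hN).le

/-- Weak closeness to a law determined by its moments follows from the closeness of finitely many
moments. -/
theorem exists_forall_abs_integral_sub_lt {c : ℕ → ℝ} (hc : FactorialBound c) {μ : Measure ℝ}
    [IsProbabilityMeasure μ] (hμ : HasMoments μ c) (f : BoundedContinuousFunction ℝ ℝ) {ε : ℝ}
    (hε : 0 < ε) :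
    ∃ N : ℕ, ∀ ν : Measure ℝ, IsProbabilityMeasure ν →
      (∀ k : ℕ, Integrable (fun x : ℝ => x ^ k) ν) →
      (∀ k : ℕ, 1 ≤ k → k ≤ N → |mom ν k - c k| < 1 / ((N : ℝ) + 1)) →
      |∫ x, f x ∂ν - ∫ x, f x ∂μ| ≤ ε := by
  -- Otherwise there is for each `N` a law that is far from `μ` although its first `N` moments are
  -- close to `c`. A subsequence converges weakly to a law with moments `c`, that is to `μ`: a
  -- contradiction.
  by_contra! hcon
  choose ν hν hint hclose hfar using hcon
  obtain ⟨φ, μ', hφ, hlim, hμ'⟩ := exists_subseq_tendsto_of_tendsto_mom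
    (ν := fun N => ⟨ν N, hν N⟩) (c := c) hint
    (tendsto_mom_of_abs_sub_lt (ν := fun N => ⟨ν N, hν N⟩) hclose)
  have heq : (μ' : Measure ℝ) = μ := eq_of_hasMoments hc hμ' hμ
  have hf := (ProbabilityMeasure.tendsto_iff_forall_integral_tendsto.1 hlim) f
  rw [heq] at hf
  obtain ⟨N, hN⟩ := (Metric.tendsto_atTop.1 hf) ε hε
  have h1 := hN N le_rfl
  have h2 := hfar (φ N)
  rw [Real.dist_eq] at h1
  exact absurd (h2.trans h1) (lt_irrefl _)

/-! ### Multiplicities and products of moments -/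

/-- The number of times that the family `f` takes the value `p`. -/
def mult {T S : Type*} (f : T → S) (p : S) : ℕ := Nat.card {t : T // f t = p}

section mult

variable {T S S' : Type*}

theorem mult_comp_apply (f : T → S) {g : S → S'} (hg : Function.Injective g) (p : S) :
    mult (g ∘ f) (g p) = mult f p := by
  unfold mult
  exact Nat.card_congr (Equiv.subtypeEquivRight fun t => hg.eq_iff)

theorem mult_eq_zero {f : T → S} {p : S} (h : p ∉ Set.range f) : mult f p = 0 := by
  have : IsEmpty {t : T // f t = p} := ⟨fun t => h ⟨t.1, t.2⟩⟩
  exact Nat.card_of_isEmpty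

theorem mult_pos_iff [Finite T] {f : T → S} {p : S} : 0 < mult f p ↔ p ∈ Set.range f := by
  refine ⟨fun h => by_contra fun hp => by simp [mult_eq_zero hp] at h, ?_⟩
  rintro ⟨t, rfl⟩
  have : Nonempty {t' : T // f t' = f t} := ⟨⟨t, rfl⟩⟩
  exact Nat.card_pos

theorem mult_sumElim [Finite T] {T' : Type*} [Finite T'] (f : T → S) (f' : T' → S) (p : S) :
    mult (Sum.elim f f') p = mult f p + mult f' p := by
  unfold mult
  rw [← Nat.card_sum]
  exact Nat.card_congr (Equiv.subtypeSum.trans (Equiv.refl _))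

theorem mult_eq_card_filter [Fintype T] [DecidableEq S] (f : T → S) (p : S) :
    mult f p = (Finset.univ.filter fun t => f t = p).card := by
  rw [mult, Nat.card_eq_fintype_card, Fintype.card_subtype]

theorem prod_pow_mult [Fintype T] [Fintype S] (f : T → S) (x : S → ℝ) :
    ∏ t, x (f t) = ∏ p, x p ^ mult f p := by
  classical
  rw [← Finset.prod_fiberwise Finset.univ f]
  refine Finset.prod_congr rfl fun p _ => ?_
  rw [mult_eq_card_filter, Finset.prod_congr rfl (g := fun _ => x p), Finset.prod_const]
  intro t ht
  rw [(Finset.mem_filter.1 ht).2]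

end mult

/-- The product of the moments of `P` whose orders are the multiplicities of `f`. -/
def momProd {T S : Type*} [Fintype S] (P : Measure ℝ) (f : T → S) : ℝ := ∏ p, mom P (mult f p)

theorem mom_zero (P : Measure ℝ) [IsProbabilityMeasure P] : mom P 0 = 1 := by simp [mom]

/-- Values that are not taken contribute `mom P 0 = 1`, so only the coincidences within `f` matter.
This is why the expectation attached to a word depends only on its kernels. -/
theorem momProd_comp {T S S' : Type*} [Fintype S] [Fintype S'] (P : Measure ℝ)
    [IsProbabilityMeasure P] (f : T → S) {g : S → S'} (hg : Function.Injective g) :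
    momProd P (g ∘ f) = momProd P f := by
  unfold momProd
  symm
  refine Finset.prod_of_injOn g hg.injOn (fun _ _ => by simp) ?_ ?_
  · intro p _ hp
    rw [mult_eq_zero, mom_zero]
    rintro ⟨t, rfl⟩
    exact hp ⟨f t, by simp⟩
  · intro p _
    rw [mult_comp_apply f hg]

/-- Each value is taken by at most one of the two families. This is the form in which independence
makes covariances vanish. -/
theorem momProd_sumElim {T T' S : Type*} [Finite T] [Finite T'] [Fintype S] (P : Measure ℝ)
    [IsProbabilityMeasure P] (f : T → S) (f' : T' → S)
    (h : Disjoint (Set.range f) (Set.range f')) :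
    momProd P (Sum.elim f f') = momProd P f * momProd P f' := by
  unfold momProd
  rw [← Finset.prod_mul_distrib]
  refine Finset.prod_congr rfl fun p _ => ?_
  rw [mult_sumElim]
  by_cases hp : p ∈ Set.range f
  · rw [mult_eq_zero (Set.disjoint_left.1 h hp), mom_zero, mul_one, add_zero]
  · rw [mult_eq_zero hp, mom_zero, one_mul, zero_add]

/-! ### Expectations of products of independent entries. -/

section expectation

variable {Ω S : Type*} [MeasurableSpace Ω] {Pr : Measure Ω} [Fintype S]
  {P : Measure ℝ} {Y : S → Ω → ℝ}

theorem integrable_prod_of_iIndepFun [IsProbabilityMeasure P]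
    (hP : ∀ k : ℕ, Integrable (fun x : ℝ => x ^ k) P) (hlaw : ∀ p, HasLaw (Y p) P Pr)
    (hind : iIndepFun Y Pr) {T : Type*} [Fintype T] (f : T → S) :
    Integrable (fun ω => ∏ t, Y (f t) ω) Pr := by
  simp_rw [fun ω => prod_pow_mult f (fun p => Y p ω)]
  have hmap := hind.map_fun_eq_pi_map (fun p => (hlaw p).aemeasurable)
  simp_rw [fun p => (hlaw p).map_eq] at hmap
  have h : Integrable (fun x : S → ℝ => ∏ p, x p ^ mult f p) (Measure.pi fun _ : S => P) :=
    Integrable.fintype_prod (f := fun p x => x ^ mult f p) fun p => hP _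
  rw [← hmap] at h
  exact h.comp_aemeasurable (aemeasurable_pi_lambda _ fun p => (hlaw p).aemeasurable)

theorem integral_prod_of_iIndepFun (hlaw : ∀ p, HasLaw (Y p) P Pr) (hind : iIndepFun Y Pr)
    {T : Type*} [Fintype T] (f : T → S) : ∫ ω, ∏ t, Y (f t) ω ∂Pr = momProd P f := by
  simp_rw [fun ω => prod_pow_mult f (fun p => Y p ω)]
  rw [hind.integral_fun_prod_comp (f := fun p x => x ^ mult f p)
    (fun p => (hlaw p).aemeasurable) (fun p => by fun_prop)]
  refine Finset.prod_congr rfl fun p _ => ?_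
  exact (hlaw p).integral_comp (f := fun x => x ^ mult f p) (by fun_prop)

end expectation

/-! ### Traces of powers -/

theorem pow_succ_apply_eq_sum {ι : Type*} [Fintype ι] [DecidableEq ι] (M : Matrix ι ι ℝ) (K : ℕ) :
    ∀ a b : ι, (M ^ (K + 1)) a b = ∑ i : Fin K → ι,
      ∏ t : Fin (K + 1), M ((Fin.cons a i : Fin (K + 1) → ι) t)
        ((Fin.snoc i b : Fin (K + 1) → ι) t) := by
  induction K with
  | zero =>
    intro a b
    simp [Fin.snoc]
  | succ K ih =>
    intro a b
    rw [pow_succ', Matrix.mul_apply, ← (Fin.consEquiv (fun _ => ι)).sum_comp, Fintype.sum_prod_type]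
    refine Finset.sum_congr rfl fun c _ => ?_
    rw [ih, Finset.mul_sum]
    refine Finset.sum_congr rfl fun i _ => ?_
    have he : Fin.consEquiv (fun _ => ι) (c, i) = (Fin.cons c i : Fin (K + 1) → ι) := rfl
    conv_rhs => rw [Fin.prod_univ_succ]
    rw [he, ← Fin.cons_snoc_eq_snoc_cons]
    simp only [Fin.cons_zero, Fin.cons_succ]

theorem snoc_tail_eq {ι : Type*} {K : ℕ} (x : Fin (K + 1) → ι) (t : Fin (K + 1)) :
    (Fin.snoc (Fin.tail x) (x 0) : Fin (K + 1) → ι) t = x (t + 1) := by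
  refine Fin.lastCases ?_ (fun t => ?_) t
  · simp
  · simp [Fin.tail]

/-- The addition `t + 1` in `Fin (K + 1)` is cyclic, so the step that closes the word needs no
separate treatment. -/
theorem trace_pow_succ_eq_sum {ι : Type*} [Fintype ι] [DecidableEq ι] (M : Matrix ι ι ℝ) (K : ℕ) :
    (M ^ (K + 1)).trace = ∑ x : Fin (K + 1) → ι, ∏ t, M (x t) (x (t + 1)) := by
  rw [Matrix.trace, ← (Fin.consEquiv (fun _ => ι)).sum_comp, Fintype.sum_prod_type]
  refine Finset.sum_congr rfl fun a _ => ?_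
  rw [Matrix.diag_apply, pow_succ_apply_eq_sum]
  refine Finset.sum_congr rfl fun i _ => Finset.prod_congr rfl fun t _ => ?_
  have := snoc_tail_eq (Fin.cons a i : Fin (K + 1) → ι) t
  rw [Fin.tail_cons, Fin.cons_zero] at this
  rw [this]
  rfl

/-- The steps of the closed alternating word `x₀ y₀ x₁ y₁ ⋯ x_K y_K x₀`, as pairs
(row letter, column letter). -/
def steps {K : ℕ} {α β : Type*} (x : Fin (K + 1) → α) (y : Fin (K + 1) → β) :
    Fin (K + 1) × Bool → α × β
  | (t, false) => (x t, y t)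
  | (t, true) => (x (t + 1), y t)

theorem steps_comp {K : ℕ} {α β α' β' : Type*} (x : Fin (K + 1) → α) (y : Fin (K + 1) → β)
    (f : α → α') (g : β → β') : steps (f ∘ x) (g ∘ y) = Prod.map f g ∘ steps x y := by
  ext ⟨t, _ | _⟩ <;> rfl

theorem trace_mul_transpose_pow {n m : ℕ} (X : Matrix (Fin n) (Fin m) ℝ) (K : ℕ) :
    ((X * X.transpose) ^ (K + 1)).trace = ∑ x : Fin (K + 1) → Fin n, ∑ y : Fin (K + 1) → Fin m,
      ∏ t, X (steps x y t).1 (steps x y t).2 := by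
  rw [trace_pow_succ_eq_sum]
  refine Finset.sum_congr rfl fun x _ => ?_
  simp_rw [Matrix.mul_apply, Matrix.transpose_apply]
  rw [Finset.prod_univ_sum, Fintype.piFinset_univ]
  refine Finset.sum_congr rfl fun y _ => ?_
  rw [Fintype.prod_prod_type]
  refine Finset.prod_congr rfl fun t _ => ?_
  rw [Fintype.prod_bool, mul_comm]
  rfl

theorem sum_eigenvalues_pow {n : ℕ} {M : Matrix (Fin n) (Fin n) ℝ} (hM : M.IsHermitian) (k : ℕ) :
    ∑ i, hM.eigenvalues i ^ k = (M ^ k).trace := by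
  conv_rhs => rw [hM.spectral_theorem, ← map_pow, Matrix.diagonal_pow,
    Unitary.conjStarAlgAut_apply, Matrix.trace_mul_cycle, Unitary.coe_star_mul_self, one_mul,
    Matrix.trace_diagonal]
  rfl

theorem isProbabilityMeasure_spectralMeasure {n : ℕ} (hn : 1 ≤ n)
    {M : Matrix (Fin n) (Fin n) ℝ} (hM : M.IsHermitian) :
    IsProbabilityMeasure (spectralMeasure hM) := by
  refine ⟨?_⟩
  simp only [spectralMeasure, Measure.smul_apply, Measure.coe_finsetSum, Finset.sum_apply,
    measure_univ, Finset.sum_const, Finset.card_univ, Fintype.card_fin, nsmul_eq_mul, mul_one,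
    smul_eq_mul]
  exact ENNReal.inv_mul_cancel (by simp; omega) (by simp)

theorem integrable_spectralMeasure {n : ℕ} (hn : 1 ≤ n) {M : Matrix (Fin n) (Fin n) ℝ}
    (hM : M.IsHermitian) (g : ℝ → ℝ) : Integrable g (spectralMeasure hM) := by
  refine Integrable.smul_measure ?_ (by simp; omega)
  rw [integrable_finsetSum_measure]
  intro i _
  exact integrable_dirac (by simp)

theorem mom_spectralMeasure {n : ℕ} {M : Matrix (Fin n) (Fin n) ℝ}
    (hM : M.IsHermitian) (k : ℕ) : mom (spectralMeasure hM) k = (n : ℝ)⁻¹ * (M ^ k).trace := by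
  rw [mom, spectralMeasure, integral_smul_measure,
    integral_finsetSum_measure (fun i _ => integrable_dirac (by simp))]
  simp [← sum_eigenvalues_pow hM]

/-! ### Sums over words, grouped by kernels -/

instance finite_setoid {R : Type*} [Finite R] : Finite (Setoid R) :=
  Finite.of_injective (fun π : Setoid R => fun a b => π a b) fun _ _ h =>
    Setoid.ext fun a b => iff_of_eq (congrFun (congrFun h a) b)

instance fintype_setoid {R : Type*} [Finite R] : Fintype (Setoid R) := Fintype.ofFinite _

instance fintype_quotient_setoid {R : Type*} [Finite R] (π : Setoid R) : Fintype (Quotient π) :=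
  Fintype.ofFinite _

theorem ker_comp_mk {R X : Type*} {π : Setoid R} {f : Quotient π → X}
    (hf : Function.Injective f) : Setoid.ker (f ∘ Quotient.mk π) = π := by
  ext a b
  rw [Setoid.ker_def, Function.comp_apply, Function.comp_apply, hf.eq_iff, Quotient.eq]

/-- A function amounts to its kernel together with an injection of the quotient by the kernel. -/
theorem sum_fun_eq_sum_setoid {R X M : Type*} [Fintype R] [DecidableEq R] [Fintype X]
    [AddCommMonoid M] (F : (R → X) → M) :
    ∑ i, F i = ∑ π : Setoid R, ∑ᶠ f : Quotient π ↪ X, F (f ∘ Quotient.mk π) := by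
  classical
  rw [← Finset.sum_fiberwise Finset.univ (Setoid.ker : (R → X) → Setoid R)]
  refine Finset.sum_congr rfl fun π _ => ?_
  rw [finsum_eq_sum_of_fintype]
  symm
  refine Finset.sum_bij (fun f _ => f ∘ Quotient.mk π) ?_ ?_ ?_ ?_
  · intro f _
    simpa using ker_comp_mk f.injective
  · intro f _ g _ h
    ext q
    induction q using Quotient.inductionOn with
    | h a => exact congrFun h a
  · intro i hi
    obtain rfl : Setoid.ker i = π := by simpa using hi
    exact ⟨⟨Setoid.kerLift i, Setoid.kerLift_injective i⟩, Finset.mem_univ _, rfl⟩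
  · intros
    rfl

/-- A sum over pairs of words whose terms depend only on the kernels of the words. -/
theorem sum_sum_eq_of_kernel {R C : Type*} [Fintype R] [Fintype C] [DecidableEq R]
    [DecidableEq C] {n m : ℕ} (F : (R → Fin n) → (C → Fin m) → ℝ)
    (Φ : Setoid R → Setoid C → ℝ)
    (h : ∀ (π : Setoid R) (ρ : Setoid C) (f : Quotient π ↪ Fin n) (g : Quotient ρ ↪ Fin m),
      F (f ∘ Quotient.mk π) (g ∘ Quotient.mk ρ) = Φ π ρ) :
    ∑ x, ∑ y, F x y = ∑ π : Setoid R, ∑ ρ : Setoid C,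
      (n.descFactorial (Nat.card (Quotient π)) : ℝ) *
        (m.descFactorial (Nat.card (Quotient ρ)) : ℝ) * Φ π ρ := by
  classical
  rw [sum_fun_eq_sum_setoid]
  refine Finset.sum_congr rfl fun π _ => ?_
  have h1 : ∀ f : Quotient π ↪ Fin n, ∑ y, F (f ∘ Quotient.mk π) y =
      ∑ ρ : Setoid C, (m.descFactorial (Nat.card (Quotient ρ)) : ℝ) * Φ π ρ := by
    intro f
    rw [sum_fun_eq_sum_setoid]
    refine Finset.sum_congr rfl fun ρ _ => ?_
    rw [finsum_eq_sum_of_fintype, Finset.sum_congr rfl fun g _ => h π ρ f g, Finset.sum_const,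
      Finset.card_univ, Fintype.card_embedding_eq, Fintype.card_fin, nsmul_eq_mul,
      Nat.card_eq_fintype_card]
  rw [finsum_eq_sum_of_fintype, Finset.sum_congr rfl fun f _ => h1 f, Finset.sum_const,
    Finset.card_univ, Fintype.card_embedding_eq, Fintype.card_fin, nsmul_eq_mul,
    Finset.mul_sum, Nat.card_eq_fintype_card]
  simp_rw [mul_assoc]

/-! ### Normalized moments -/

/-- The moments of `P`, normalized as in the limit theorem. -/
def normMom (P : Measure ℝ) (n b : ℕ) : ℝ :=
  mom P b / ((n : ℝ) ^ ((b : ℝ) / 2 - 1) * mom P 2 ^ ((b : ℝ) / 2))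

open Classical in
/-- The set of values of a finite family. -/
def values {T S : Type*} [Fintype T] (f : T → S) : Finset S := Finset.univ.image f

theorem mem_values {T S : Type*} [Fintype T] {f : T → S} {p : S} :
    p ∈ values f ↔ p ∈ Set.range f := by
  simp [values]

theorem values_card {T S : Type*} [Fintype T] (f : T → S) :
    (values f).card = Nat.card (Set.range f) := by
  rw [← Set.ncard_coe_finset, Nat.card_coe_set_eq]
  congr
  ext p
  exact mem_values

theorem sum_mult_values {T S : Type*} [Fintype T] (f : T → S) :
    ∑ p ∈ values f, mult f p = Fintype.card T := by
  classical
  simp_rw [mult_eq_card_filter]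
  exact (Finset.card_eq_sum_card_fiberwise (f := f) (s := Finset.univ) (t := values f)
    (fun t _ => mem_values.2 ⟨t, rfl⟩)).symm

/-- The product of the numbers `c b`, where `b` runs over the multiplicities of the values of
`f`. -/
def multProd {T S : Type*} [Fintype T] (c : ℕ → ℝ) (f : T → S) : ℝ :=
  ∏ p ∈ values f, c (mult f p)

/-- The multiplicities add up to `2 * K`, so the exponents `b / 2` add up to `K` and the exponents
`b / 2 - 1` to `K` minus the number of values: each distinct value costs a factor `n`. -/
theorem momProd_eq {T S : Type*} [Fintype T] [Fintype S] {P : Measure ℝ} [IsProbabilityMeasure P]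
    (hv : 0 < mom P 2) {n : ℕ} (hn : 1 ≤ n) (f : T → S) {K : ℕ} (hK : Fintype.card T = 2 * K) :
    momProd P f = multProd (normMom P n) f * ((n * mom P 2) ^ K / (n : ℝ) ^ (values f).card) := by
  have hn0 : (0 : ℝ) < n := by exact_mod_cast hn
  have hsum : ∑ p ∈ values f, ((mult f p : ℕ) : ℝ) = 2 * K := by
    exact_mod_cast (sum_mult_values f).trans hK
  have h1 : momProd P f = ∏ p ∈ values f, mom P (mult f p) := by
    refine (Finset.prod_subset (Finset.subset_univ _) ?_).symm
    intro p _ hp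
    rw [mult_eq_zero (fun h => hp (mem_values.2 h)), mom_zero]
  have h2 : ∀ b : ℕ, mom P b =
      normMom P n b * ((n : ℝ) ^ ((b : ℝ) / 2 - 1) * mom P 2 ^ ((b : ℝ) / 2)) := fun b => by
    have := Real.rpow_pos_of_pos hn0 ((b : ℝ) / 2 - 1)
    have := Real.rpow_pos_of_pos hv ((b : ℝ) / 2)
    rw [normMom, div_mul_cancel₀]
    positivity
  rw [h1, Finset.prod_congr rfl fun p _ => h2 (mult f p), Finset.prod_mul_distrib,
    Finset.prod_mul_distrib, ← Real.rpow_sum_of_pos hn0, ← Real.rpow_sum_of_pos hv, multProd]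
  congr 1
  rw [Finset.sum_sub_distrib, ← Finset.sum_div, hsum, mul_div_cancel_left₀ _ two_ne_zero,
    Finset.sum_const, nsmul_eq_mul, mul_one, Real.rpow_sub hn0, Real.rpow_natCast,
    Real.rpow_natCast, Real.rpow_natCast, mul_pow]
  ring

theorem tendsto_multProd {T S : Type*} [Fintype T] {c : ℕ → ℕ → ℝ} {A : ℕ → ℝ}
    (h : ∀ b, 1 ≤ b → Tendsto (fun n => c n b) atTop (𝓝 (A b))) (f : T → S) :
    Tendsto (fun n => multProd (c n) f) atTop (𝓝 (multProd A f)) := by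
  refine tendsto_finsetProd _ fun p hp => h _ ?_
  exact mult_pos_iff.2 (mem_values.1 hp)

/-! ### Asymptotics of the number of words with given kernels -/

theorem tendsto_descFactorial_div_pow (p : ℕ) :
    Tendsto (fun n : ℕ => (n.descFactorial p : ℝ) / (n : ℝ) ^ p) atTop (𝓝 1) := by
  refine (Asymptotics.isEquivalent_iff_tendsto_one ?_).1 (isEquivalent_descFactorial p)
  filter_upwards [eventually_ge_atTop 1] with n hn
  have : (0 : ℝ) < n := by exact_mod_cast hn
  positivity

theorem tendsto_atTop_of_ratio {α : ℝ} (hα : 0 < α) {m : ℕ → ℕ}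
    (hm : Tendsto (fun n : ℕ => (m n : ℝ) / (n : ℝ)) atTop (𝓝 α)) : Tendsto m atTop atTop := by
  rw [← tendsto_natCast_atTop_iff (R := ℝ)]
  refine (hm.pos_mul_atTop hα (tendsto_natCast_atTop_atTop (R := ℝ))).congr' ?_
  filter_upwards [eventually_ge_atTop 1] with n hn
  have : (0 : ℝ) < n := by exact_mod_cast hn
  field_simp

theorem tendsto_descFactorial_mul {α : ℝ} (hα : 0 < α) {m : ℕ → ℕ}
    (hm : Tendsto (fun n : ℕ => (m n : ℝ) / (n : ℝ)) atTop (𝓝 α)) (p q : ℕ) :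
    Tendsto (fun n : ℕ => (n.descFactorial p : ℝ) * ((m n).descFactorial q : ℝ) /
      (n : ℝ) ^ (p + q)) atTop (𝓝 (α ^ q)) := by
  have hmt := tendsto_atTop_of_ratio hα hm
  have h := ((tendsto_descFactorial_div_pow p).mul
    ((tendsto_descFactorial_div_pow q).comp hmt)).mul (hm.pow q)
  rw [one_mul, one_mul] at h
  refine h.congr' ?_
  filter_upwards [eventually_ge_atTop 1, hmt.eventually_ge_atTop 1] with n hn hmn
  have : (0 : ℝ) < n := by exact_mod_cast hn
  have : (0 : ℝ) < m n := by exact_mod_cast hmn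
  simp only [Function.comp_apply]
  rw [div_pow, pow_add]
  field_simp

/-- The product of falling factorials has order `n ^ (p + q)`, so it survives division by `n ^ e`
only when `p + q = e`. -/
theorem tendsto_descFactorial_mul_div {α : ℝ} (hα : 0 < α) {m : ℕ → ℕ}
    (hm : Tendsto (fun n : ℕ => (m n : ℝ) / (n : ℝ)) atTop (𝓝 α)) {p q e : ℕ} (he : p + q ≤ e) :
    Tendsto (fun n : ℕ => (n.descFactorial p : ℝ) * ((m n).descFactorial q : ℝ) /
      (n : ℝ) ^ e) atTop (𝓝 (if p + q = e then α ^ q else 0)) := by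
  split_ifs with h
  · rw [← h]
    exact tendsto_descFactorial_mul hα hm p q
  · obtain ⟨d, rfl⟩ := Nat.exists_eq_add_of_lt (lt_of_le_of_ne he h)
    have h0 : Tendsto (fun n : ℕ => ((n : ℝ) ^ (d + 1))⁻¹) atTop (𝓝 0) :=
      tendsto_inv_atTop_zero.comp ((tendsto_pow_atTop (by omega)).comp
        tendsto_natCast_atTop_atTop)
    have h1 := (tendsto_descFactorial_mul hα hm p q).mul h0
    rw [mul_zero] at h1
    refine h1.congr fun n => ?_
    rw [add_assoc (p + q) d 1, pow_add _ (p + q) (d + 1), div_mul_eq_div_div,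
      div_eq_mul_inv _ (_ ^ (d + 1))]

/-! ### The bipartite graph of a word -/

/-- The bipartite graph with edges `E`. -/
def bipGraph {α β : Type*} (E : Set (α × β)) : SimpleGraph (α ⊕ β) where
  Adj
    | Sum.inl a, Sum.inr b => (a, b) ∈ E
    | Sum.inr b, Sum.inl a => (a, b) ∈ E
    | _, _ => False
  symm := ⟨by rintro (a | a) (b | b) h <;> exact h⟩
  loopless := ⟨by rintro (a | a) h <;> exact h⟩

section bipGraph

variable {α β : Type*} {E : Set (α × β)}

/-- The edges of the bipartite graph with edges `E`. -/
def bipGraphEdges (E : Set (α × β)) : E ≃ (bipGraph E).edgeSet :=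
  Equiv.ofBijective (fun p => ⟨s(Sum.inl p.1.1, Sum.inr p.1.2), p.2⟩) (by
    constructor
    · rintro ⟨⟨a, b⟩, h⟩ ⟨⟨a', b'⟩, h'⟩ heq
      have := congrArg Subtype.val heq
      simpa using this
    · rintro ⟨e, he⟩
      induction e using Sym2.ind with
      | _ u v =>
        rcases u with a | b <;> rcases v with a' | b'
        · exact False.elim he
        · exact ⟨⟨(a, b'), he⟩, rfl⟩
        · exact ⟨⟨(a', b), he⟩, Subtype.ext Sym2.eq_swap⟩
        · exact False.elim he)

theorem bipGraphEdges_apply (p : E) :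
    (bipGraphEdges E p : Sym2 (α ⊕ β)) = s(Sum.inl p.1.1, Sum.inr p.1.2) := rfl

theorem reachable_steps {K : ℕ} {x : Fin (K + 1) → α} {y : Fin (K + 1) → β}
    (h : Set.range (steps x y) ⊆ E) (t : Fin (K + 1)) :
    (bipGraph E).Reachable (Sum.inl (x 0)) (Sum.inl (x t)) ∧
      (bipGraph E).Reachable (Sum.inl (x 0)) (Sum.inr (y t)) := by
  have hf : ∀ t, (bipGraph E).Adj (Sum.inl (x t)) (Sum.inr (y t)) := fun t => h ⟨(t, false), rfl⟩
  have ht : ∀ t, (bipGraph E).Adj (Sum.inr (y t)) (Sum.inl (x (t + 1))) :=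
    fun t => h ⟨(t, true), rfl⟩
  have key : ∀ t, (bipGraph E).Reachable (Sum.inl (x 0)) (Sum.inl (x t)) := by
    intro t
    induction t using Fin.induction with
    | zero => exact SimpleGraph.Reachable.refl _
    | succ t ih =>
      rw [← Fin.coeSucc_eq_succ]
      exact (ih.trans (hf _).reachable).trans (ht _).reachable
  exact ⟨key t, (key t).trans (hf t).reachable⟩

/-- A connected graph has at most one vertex more than it has edges. This inequality bounds every
power of `n` in the mean and in the variance. -/
theorem card_add_card_le_of_connected [Fintype α] [Fintype β] {T : Type*} [Fintype T]
    {f : T → α × β} (h : (bipGraph (Set.range f)).Connected) :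
    Nat.card α + Nat.card β ≤ (values f).card + 1 := by
  have := h.card_vert_le_card_edgeSet_add_one
  rw [Nat.card_sum, ← Nat.card_congr (bipGraphEdges _)] at this
  convert this using 2
  exact values_card f

theorem connected_steps {K : ℕ} {x : Fin (K + 1) → α} {y : Fin (K + 1) → β}
    (hx : Function.Surjective x) (hy : Function.Surjective y) :
    (bipGraph (Set.range (steps x y))).Connected := by
  rw [SimpleGraph.connected_iff_exists_forall_reachable]
  refine ⟨Sum.inl (x 0), ?_⟩
  rintro (a | b)
  · obtain ⟨t, rfl⟩ := hx a
    exact (reachable_steps subset_rfl t).1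
  · obtain ⟨t, rfl⟩ := hy b
    exact (reachable_steps subset_rfl t).2

/-- The steps of a pair of words. -/
def stepsPair {K : ℕ} (x : Fin (K + 1) ⊕ Fin (K + 1) → α) (y : Fin (K + 1) ⊕ Fin (K + 1) → β) :
    (Fin (K + 1) × Bool) ⊕ (Fin (K + 1) × Bool) → α × β :=
  Sum.elim (steps (x ∘ Sum.inl) (y ∘ Sum.inl)) (steps (x ∘ Sum.inr) (y ∘ Sum.inr))

/-- Each of the two words traces a connected graph, and a common edge joins them. -/
theorem connected_stepsPair {K : ℕ} {x : Fin (K + 1) ⊕ Fin (K + 1) → α}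
    {y : Fin (K + 1) ⊕ Fin (K + 1) → β}
    (hx : Function.Surjective x) (hy : Function.Surjective y)
    (h : ¬ Disjoint (Set.range (steps (x ∘ Sum.inl) (y ∘ Sum.inl)))
      (Set.range (steps (x ∘ Sum.inr) (y ∘ Sum.inr)))) :
    (bipGraph (Set.range (stepsPair x y))).Connected := by
  set E := Set.range (stepsPair x y)
  have hl : Set.range (steps (x ∘ Sum.inl) (y ∘ Sum.inl)) ⊆ E := by
    rintro _ ⟨t, rfl⟩
    exact ⟨Sum.inl t, rfl⟩
  have hr : Set.range (steps (x ∘ Sum.inr) (y ∘ Sum.inr)) ⊆ E := by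
    rintro _ ⟨t, rfl⟩
    exact ⟨Sum.inr t, rfl⟩
  obtain ⟨p, ⟨⟨t, b⟩, ht⟩, ⟨⟨t', b'⟩, ht'⟩⟩ := Set.not_disjoint_iff.1 h
  -- Both steps with index `t` have column letter `y t`, whatever their direction.
  have hy' : y (Sum.inl t) = y (Sum.inr t') := by
    have h2 := congrArg Prod.snd (ht.trans ht'.symm)
    rcases b with _ | _ <;> rcases b' with _ | _ <;> exact h2
  have hjoin : (bipGraph E).Reachable (Sum.inl (x (Sum.inl 0))) (Sum.inl (x (Sum.inr 0))) := by
    have h1 := (reachable_steps hl t).2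
    have h2 := (reachable_steps hr t').2
    simp only [Function.comp_apply] at h1 h2
    rw [hy'] at h1
    exact h1.trans h2.symm
  rw [SimpleGraph.connected_iff_exists_forall_reachable]
  refine ⟨Sum.inl (x (Sum.inl 0)), ?_⟩
  rintro (a | b)
  · obtain ⟨t | t, rfl⟩ := hx a
    · exact (reachable_steps hl t).1
    · exact hjoin.trans (reachable_steps hr t).1
  · obtain ⟨t | t, rfl⟩ := hy b
    · exact (reachable_steps hl t).2
    · exact hjoin.trans (reachable_steps hr t).2

end bipGraph

/-! ### Mean and variance of the moments of the spectral measure -/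

/-- The steps of the word formed by the classes of its positions. -/
def quotSteps {K : ℕ} (π ρ : Setoid (Fin (K + 1))) :
    Fin (K + 1) × Bool → Quotient π × Quotient ρ :=
  steps (Quotient.mk π) (Quotient.mk ρ)

/-- The sum over the pairs of kernels whose graph is a tree. -/
def kernelSum (A : ℕ → ℝ) (α : ℝ) (K : ℕ) : ℝ :=
  ∑ π : Setoid (Fin (K + 1)), ∑ ρ : Setoid (Fin (K + 1)),
    (if Nat.card (Quotient π) + Nat.card (Quotient ρ) = (values (quotSteps π ρ)).card + 1
      then α ^ Nat.card (Quotient ρ) else 0) * multProd A (quotSteps π ρ)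

/-- A pair of words is treated as one word on `R ⊕ R` and `C ⊕ C`, so that the grouping by kernels
also records the coincidences between the two words. -/
theorem sum_sum_sq {R C X Y : Type*} [Fintype R] [Fintype C] [DecidableEq R] [DecidableEq C]
    [Fintype X] [Fintype Y] (F G : (R → X) → (C → Y) → ℝ) :
    (∑ x, ∑ y, F x y) * (∑ x, ∑ y, G x y) = ∑ x : R ⊕ R → X, ∑ y : C ⊕ C → Y,
      F (x ∘ Sum.inl) (y ∘ Sum.inl) * G (x ∘ Sum.inr) (y ∘ Sum.inr) := by
  rw [← (Equiv.sumArrowEquivProdArrow R R X).symm.sum_comp, Fintype.sum_prod_type,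
    Finset.sum_mul_sum]
  refine Finset.sum_congr rfl fun x _ => Finset.sum_congr rfl fun x' _ => ?_
  rw [← (Equiv.sumArrowEquivProdArrow C C Y).symm.sum_comp, Fintype.sum_prod_type,
    Finset.sum_mul_sum]
  rfl

/-! ### Exact formulas for the mean and the variance at fixed `n`. -/

section fixed

variable {n m : ℕ} {Ω : Type*} [MeasurableSpace Ω] {Pr : Measure Ω} {P : Measure ℝ}
  {X : Ω → Matrix (Fin n) (Fin m) ℝ}

theorem mom_spectralMeasure_wishart (v : ℝ) (Y : Matrix (Fin n) (Fin m) ℝ) (K : ℕ) :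
    mom (spectralMeasure (wishart_isHermitian v Y)) (K + 1) =
      (n : ℝ)⁻¹ * (1 / (n * v)) ^ (K + 1) *
        ∑ x : Fin (K + 1) → Fin n, ∑ y : Fin (K + 1) → Fin m,
          ∏ t, Y (steps x y t).1 (steps x y t).2 := by
  rw [mom_spectralMeasure, wishart, smul_pow, Matrix.trace_smul, trace_mul_transpose_pow,
    smul_eq_mul, mul_assoc]

theorem integral_prod_entries (hlaw : ∀ i j, HasLaw (fun ω => X ω i j) P Pr)
    (hind : iIndepFun (fun (p : Fin n × Fin m) (ω : Ω) => X ω p.1 p.2) Pr) {T : Type*} [Fintype T]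
    (f : T → Fin n × Fin m) : ∫ ω, ∏ t, X ω (f t).1 (f t).2 ∂Pr = momProd P f :=
  integral_prod_of_iIndepFun (Y := fun (p : Fin n × Fin m) (ω : Ω) => X ω p.1 p.2)
    (fun p => hlaw p.1 p.2) hind f

theorem integrable_prod_entries [IsProbabilityMeasure P]
    (hP : ∀ k : ℕ, Integrable (fun x : ℝ => x ^ k) P)
    (hlaw : ∀ i j, HasLaw (fun ω => X ω i j) P Pr)
    (hind : iIndepFun (fun (p : Fin n × Fin m) (ω : Ω) => X ω p.1 p.2) Pr) {T : Type*} [Fintype T]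
    (f : T → Fin n × Fin m) : Integrable (fun ω => ∏ t, X ω (f t).1 (f t).2) Pr :=
  integrable_prod_of_iIndepFun (Y := fun (p : Fin n × Fin m) (ω : Ω) => X ω p.1 p.2) hP
    (fun p => hlaw p.1 p.2) hind f

variable [IsProbabilityMeasure P]

theorem integrable_mom_spectralMeasure (v : ℝ) (K : ℕ)
    (hP : ∀ k : ℕ, Integrable (fun x : ℝ => x ^ k) P)
    (hlaw : ∀ i j, HasLaw (fun ω => X ω i j) P Pr)
    (hind : iIndepFun (fun (p : Fin n × Fin m) (ω : Ω) => X ω p.1 p.2) Pr) :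
    Integrable (fun ω => mom (spectralMeasure (wishart_isHermitian v (X ω))) (K + 1)) Pr := by
  simp_rw [mom_spectralMeasure_wishart]
  refine Integrable.const_mul ?_ _
  exact integrable_finsetSum _ fun x _ => integrable_finsetSum _ fun y _ =>
    integrable_prod_entries hP hlaw hind _

theorem integral_mom_spectralMeasure (v : ℝ) (K : ℕ)
    (hP : ∀ k : ℕ, Integrable (fun x : ℝ => x ^ k) P)
    (hlaw : ∀ i j, HasLaw (fun ω => X ω i j) P Pr)
    (hind : iIndepFun (fun (p : Fin n × Fin m) (ω : Ω) => X ω p.1 p.2) Pr) :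
    ∫ ω, mom (spectralMeasure (wishart_isHermitian v (X ω))) (K + 1) ∂Pr =
      (n : ℝ)⁻¹ * (1 / (n * v)) ^ (K + 1) *
        ∑ x : Fin (K + 1) → Fin n, ∑ y : Fin (K + 1) → Fin m, momProd P (steps x y) := by
  simp_rw [mom_spectralMeasure_wishart]
  rw [integral_const_mul, integral_finsetSum _ fun x _ => integrable_finsetSum _ fun y _ =>
    integrable_prod_entries hP hlaw hind _]
  congr 1
  refine Finset.sum_congr rfl fun x _ => ?_
  rw [integral_finsetSum _ fun y _ => integrable_prod_entries hP hlaw hind _]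
  exact Finset.sum_congr rfl fun y _ => integral_prod_entries hlaw hind _

/-- The normalization of the matrix cancels the factor `(n * mom P 2) ^ (K + 1)` of `momProd_eq`.
What remains is one factor `n⁻¹` per edge and one from the spectral measure. -/
theorem integral_mom_eq_sum_kernels (hn : 1 ≤ n) (hv : 0 < mom P 2) (K : ℕ)
    (hP : ∀ k : ℕ, Integrable (fun x : ℝ => x ^ k) P)
    (hlaw : ∀ i j, HasLaw (fun ω => X ω i j) P Pr)
    (hind : iIndepFun (fun (p : Fin n × Fin m) (ω : Ω) => X ω p.1 p.2) Pr) :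
    ∫ ω, mom (spectralMeasure (wishart_isHermitian (mom P 2) (X ω))) (K + 1) ∂Pr =
      ∑ π : Setoid (Fin (K + 1)), ∑ ρ : Setoid (Fin (K + 1)),
        (n.descFactorial (Nat.card (Quotient π)) : ℝ) *
          (m.descFactorial (Nat.card (Quotient ρ)) : ℝ) /
            (n : ℝ) ^ ((values (quotSteps π ρ)).card + 1) *
          multProd (normMom P n) (quotSteps π ρ) := by
  rw [integral_mom_spectralMeasure _ _ hP hlaw hind,
    sum_sum_eq_of_kernel _ (fun π ρ => momProd P (quotSteps π ρ)) ?_, Finset.mul_sum]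
  · refine Finset.sum_congr rfl fun π _ => ?_
    rw [Finset.mul_sum]
    refine Finset.sum_congr rfl fun ρ _ => ?_
    rw [momProd_eq hv hn (quotSteps π ρ) (K := K + 1) (by simp; ring)]
    have : (0 : ℝ) < n := by exact_mod_cast hn
    rw [one_div, inv_pow, pow_succ _ (values (quotSteps π ρ)).card]
    field_simp
  · intro π ρ f g
    rw [steps_comp, momProd_comp _ _ (f.injective.prodMap g.injective)]
    rfl

theorem stepsPair_comp {K : ℕ} {α β α' β' : Type*} (x : Fin (K + 1) ⊕ Fin (K + 1) → α)
    (y : Fin (K + 1) ⊕ Fin (K + 1) → β) (f : α → α') (g : β → β') :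
    stepsPair (f ∘ x) (g ∘ y) = Prod.map f g ∘ stepsPair x y := by
  rw [stepsPair, stepsPair, Sum.comp_elim, ← steps_comp, ← steps_comp]
  rfl

theorem sq_mom_spectralMeasure (v : ℝ) (Y : Matrix (Fin n) (Fin m) ℝ) (K : ℕ) :
    mom (spectralMeasure (wishart_isHermitian v Y)) (K + 1) ^ 2 =
      ((n : ℝ)⁻¹ * (1 / (n * v)) ^ (K + 1)) ^ 2 *
        ∑ x : Fin (K + 1) ⊕ Fin (K + 1) → Fin n, ∑ y : Fin (K + 1) ⊕ Fin (K + 1) → Fin m,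
          ∏ t, Y (stepsPair x y t).1 (stepsPair x y t).2 := by
  rw [mom_spectralMeasure_wishart, mul_pow, sq (∑ x, _), sum_sum_sq]
  congr 1
  refine Finset.sum_congr rfl fun x _ => Finset.sum_congr rfl fun y _ => ?_
  rw [Fintype.prod_sum_type]
  rfl

theorem memLp_mom_spectralMeasure (v : ℝ) (K : ℕ)
    (hP : ∀ k : ℕ, Integrable (fun x : ℝ => x ^ k) P)
    (hlaw : ∀ i j, HasLaw (fun ω => X ω i j) P Pr)
    (hind : iIndepFun (fun (p : Fin n × Fin m) (ω : Ω) => X ω p.1 p.2) Pr) :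
    MemLp (fun ω => mom (spectralMeasure (wishart_isHermitian v (X ω))) (K + 1)) 2 Pr := by
  rw [memLp_two_iff_integrable_sq
    (integrable_mom_spectralMeasure v K hP hlaw hind).aestronglyMeasurable]
  simp_rw [sq_mom_spectralMeasure]
  refine Integrable.const_mul ?_ _
  exact integrable_finsetSum _ fun x _ => integrable_finsetSum _ fun y _ =>
    integrable_prod_entries hP hlaw hind _

/-- The contribution of a pair of kernels to the variance. -/
def kernelCov (P : Measure ℝ) {K : ℕ} (π ρ : Setoid (Fin (K + 1) ⊕ Fin (K + 1))) : ℝ :=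
  momProd P (stepsPair (Quotient.mk π) (Quotient.mk ρ)) -
    momProd P (steps (Quotient.mk π ∘ Sum.inl) (Quotient.mk ρ ∘ Sum.inl)) *
      momProd P (steps (Quotient.mk π ∘ Sum.inr) (Quotient.mk ρ ∘ Sum.inr))

theorem variance_mom_eq_sum_kernels [IsProbabilityMeasure Pr] (v : ℝ) (K : ℕ)
    (hP : ∀ k : ℕ, Integrable (fun x : ℝ => x ^ k) P)
    (hlaw : ∀ i j, HasLaw (fun ω => X ω i j) P Pr)
    (hind : iIndepFun (fun (p : Fin n × Fin m) (ω : Ω) => X ω p.1 p.2) Pr) :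
    variance (fun ω => mom (spectralMeasure (wishart_isHermitian v (X ω))) (K + 1)) Pr =
      ∑ π : Setoid (Fin (K + 1) ⊕ Fin (K + 1)), ∑ ρ : Setoid (Fin (K + 1) ⊕ Fin (K + 1)),
        (n.descFactorial (Nat.card (Quotient π)) : ℝ) *
          (m.descFactorial (Nat.card (Quotient ρ)) : ℝ) *
          (((n : ℝ)⁻¹ * (1 / (n * v)) ^ (K + 1)) ^ 2 * kernelCov P π ρ) := by
  rw [variance_eq_sub (memLp_mom_spectralMeasure v K hP hlaw hind),
    integral_mom_spectralMeasure v K hP hlaw hind, mul_pow, sq (∑ x, _), sum_sum_sq]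
  simp only [Pi.pow_apply]
  simp_rw [sq_mom_spectralMeasure]
  rw [integral_const_mul, integral_finsetSum _ fun x _ => integrable_finsetSum _ fun y _ =>
    integrable_prod_entries hP hlaw hind _, ← mul_sub, ← Finset.sum_sub_distrib]
  have h1 : ∀ x : Fin (K + 1) ⊕ Fin (K + 1) → Fin n,
      ∫ ω, ∑ y : Fin (K + 1) ⊕ Fin (K + 1) → Fin m,
          ∏ t, X ω (stepsPair x y t).1 (stepsPair x y t).2 ∂Pr =
        ∑ y : Fin (K + 1) ⊕ Fin (K + 1) → Fin m, momProd P (stepsPair x y) := by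
    intro x
    rw [integral_finsetSum _ fun y _ => integrable_prod_entries hP hlaw hind _]
    exact Finset.sum_congr rfl fun y _ => integral_prod_entries hlaw hind _
  simp_rw [h1, ← Finset.sum_sub_distrib]
  rw [sum_sum_eq_of_kernel _ (fun π ρ => kernelCov P π ρ) ?_, Finset.mul_sum]
  · refine Finset.sum_congr rfl fun π _ => ?_
    rw [Finset.mul_sum]
    exact Finset.sum_congr rfl fun ρ _ => by ring
  · intro π ρ f g
    have hfg := f.injective.prodMap g.injective
    rw [stepsPair_comp, kernelCov, ← momProd_comp P (stepsPair _ _) hfg,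
      ← momProd_comp P (steps (_ ∘ Sum.inl) _) hfg, ← momProd_comp P (steps (_ ∘ Sum.inr) _) hfg,
      ← steps_comp, ← steps_comp]
    rfl

end fixed

/-! ### Limits of the mean and of the variance. -/

section limit

variable {α : ℝ} {A : ℕ → ℝ} {P : ℕ → Measure ℝ} {m : ℕ → ℕ}

theorem kernelCov_eq_zero {P : Measure ℝ} [IsProbabilityMeasure P] {K : ℕ}
    {π ρ : Setoid (Fin (K + 1) ⊕ Fin (K + 1))}
    (h : Disjoint (Set.range (steps (Quotient.mk π ∘ Sum.inl) (Quotient.mk ρ ∘ Sum.inl)))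
      (Set.range (steps (Quotient.mk π ∘ Sum.inr) (Quotient.mk ρ ∘ Sum.inr)))) :
    kernelCov P π ρ = 0 := by
  rw [kernelCov, stepsPair, momProd_sumElim P _ _ h, sub_self]

theorem values_sumElim_card_le {T T' S : Type*} [Fintype T] [Fintype T'] (f : T → S)
    (f' : T' → S) :
    (values (Sum.elim f f')).card ≤ (values f).card + (values f').card := by
  classical
  refine le_trans (Finset.card_le_card ?_) (Finset.card_union_le _ _)
  intro p hp
  simpa [mem_values] using hp

/-- Each pair of kernels contributes a vanishing amount to the variance. -/
theorem tendsto_kernelCov (hα : 0 < α) (hP : ∀ n, 1 ≤ n → IsProbabilityMeasure (P n))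
    (hv : ∀ n, 1 ≤ n → 0 < mom (P n) 2)
    (hA : ∀ b, 1 ≤ b → Tendsto (fun n => normMom (P n) n b) atTop (𝓝 (A b)))
    (hm : Tendsto (fun n : ℕ => (m n : ℝ) / (n : ℝ)) atTop (𝓝 α)) {K : ℕ}
    (π ρ : Setoid (Fin (K + 1) ⊕ Fin (K + 1))) :
    Tendsto (fun n : ℕ => (n.descFactorial (Nat.card (Quotient π)) : ℝ) *
      ((m n).descFactorial (Nat.card (Quotient ρ)) : ℝ) *
      (((n : ℝ)⁻¹ * (1 / (n * mom (P n) 2)) ^ (K + 1)) ^ 2 * kernelCov (P n) π ρ))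
      atTop (𝓝 0) := by
  set f := steps (Quotient.mk π ∘ Sum.inl) (Quotient.mk ρ ∘ Sum.inl) with hf
  set g := steps (Quotient.mk π ∘ Sum.inr) (Quotient.mk ρ ∘ Sum.inr) with hg
  by_cases h : Disjoint (Set.range f) (Set.range g)
  · refine tendsto_const_nhds.congr' ?_
    filter_upwards [eventually_ge_atTop 1] with n hn
    have := hP n hn
    rw [kernelCov_eq_zero h, mul_zero, mul_zero]
  have hconn := connected_stepsPair Quotient.mk_surjective Quotient.mk_surjective h
  have hcard := card_add_card_le_of_connected hconn
  have hcard' : (values (stepsPair (Quotient.mk π) (Quotient.mk ρ))).card ≤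
      (values f).card + (values g).card := values_sumElim_card_le f g
  set a := (values (stepsPair (Quotient.mk π) (Quotient.mk ρ))).card with ha
  -- The square of the mean over eigenvalues gives `n ^ 2`, hence the exponent `a + 2`;
  -- connectedness of the union allows at most `a + 1` vertices.
  have h1 := (tendsto_descFactorial_mul_div hα hm
    (p := Nat.card (Quotient π)) (q := Nat.card (Quotient ρ)) (e := a + 2) (by omega)).mul
    (tendsto_multProd hA (stepsPair (Quotient.mk π) (Quotient.mk ρ)))
  -- In the product of expectations the shared edges count twice, so the exponent in the denominator
  -- is at least as large as before.
  have h2 := (tendsto_descFactorial_mul_div hα hm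
    (p := Nat.card (Quotient π)) (q := Nat.card (Quotient ρ))
    (e := (values f).card + (values g).card + 2) (by omega)).mul
    ((tendsto_multProd hA f).mul (tendsto_multProd hA g))
  rw [if_neg (by omega), zero_mul] at h1 h2
  have h3 := h1.sub h2
  rw [sub_zero] at h3
  refine h3.congr' ?_
  filter_upwards [eventually_ge_atTop 1] with n hn
  have := hP n hn
  have hvn := hv n hn
  have hn0 : (0 : ℝ) < n := by exact_mod_cast hn
  rw [kernelCov, ← hf, ← hg,
    momProd_eq hvn hn (stepsPair (Quotient.mk π) (Quotient.mk ρ)) (K := 2 * (K + 1))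
      (by simp; ring), momProd_eq hvn hn f (K := K + 1) (by simp; ring),
    momProd_eq hvn hn g (K := K + 1) (by simp; ring), ← ha]
  have hu : ((n : ℝ) * mom (P n) 2) ^ (K + 1) ≠ 0 := by positivity
  rw [pow_add _ a 2, pow_add _ ((values f).card + (values g).card) 2,
    pow_add _ (values f).card (values g).card, mul_comm 2 (K + 1), pow_mul _ (K + 1) 2, one_div,
    inv_pow]
  generalize ((n : ℝ) * mom (P n) 2) ^ (K + 1) = u at hu ⊢
  field_simp

theorem tendsto_integral_mom (hα : 0 < α) {Ω : ℕ → Type*} [∀ n, MeasurableSpace (Ω n)]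
    {Pr : ∀ n, Measure (Ω n)} {X : ∀ n, Ω n → Matrix (Fin n) (Fin (m n)) ℝ}
    (hP : ∀ n, 1 ≤ n → IsProbabilityMeasure (P n))
    (hint : ∀ n, 1 ≤ n → ∀ k : ℕ, Integrable (fun x : ℝ => x ^ k) (P n))
    (hv : ∀ n, 1 ≤ n → 0 < mom (P n) 2)
    (hA : ∀ b, 1 ≤ b → Tendsto (fun n => normMom (P n) n b) atTop (𝓝 (A b)))
    (hm : Tendsto (fun n : ℕ => (m n : ℝ) / (n : ℝ)) atTop (𝓝 α))
    (hlaw : ∀ n, 1 ≤ n → ∀ i j, HasLaw (fun ω => X n ω i j) (P n) (Pr n))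
    (hind : ∀ n, 1 ≤ n →
      iIndepFun (fun (p : Fin n × Fin (m n)) (ω : Ω n) => X n ω p.1 p.2) (Pr n)) (K : ℕ) :
    Tendsto (fun n => ∫ ω, mom (spectralMeasure
      (wishart_isHermitian (mom (P n) 2) (X n ω))) (K + 1) ∂(Pr n)) atTop
      (𝓝 (kernelSum A α K)) := by
  have key : Tendsto (fun n : ℕ => ∑ π : Setoid (Fin (K + 1)), ∑ ρ : Setoid (Fin (K + 1)),
        (n.descFactorial (Nat.card (Quotient π)) : ℝ) *
          ((m n).descFactorial (Nat.card (Quotient ρ)) : ℝ) /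
            (n : ℝ) ^ ((values (quotSteps π ρ)).card + 1) *
          multProd (normMom (P n) n) (quotSteps π ρ)) atTop (𝓝 (kernelSum A α K)) := by
    refine tendsto_finsetSum _ fun π _ => tendsto_finsetSum _ fun ρ _ => ?_
    refine (tendsto_descFactorial_mul_div hα hm ?_).mul (tendsto_multProd hA _)
    exact card_add_card_le_of_connected
      (connected_steps Quotient.mk_surjective Quotient.mk_surjective)
  refine key.congr' ?_
  filter_upwards [eventually_ge_atTop 1] with n hn
  have := hP n hn
  exact (integral_mom_eq_sum_kernels hn (hv n hn) K (hint n hn) (hlaw n hn) (hind n hn)).symm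

theorem tendsto_variance_mom (hα : 0 < α) {Ω : ℕ → Type*} [∀ n, MeasurableSpace (Ω n)]
    {Pr : ∀ n, Measure (Ω n)} [∀ n, IsProbabilityMeasure (Pr n)]
    {X : ∀ n, Ω n → Matrix (Fin n) (Fin (m n)) ℝ}
    (hP : ∀ n, 1 ≤ n → IsProbabilityMeasure (P n))
    (hint : ∀ n, 1 ≤ n → ∀ k : ℕ, Integrable (fun x : ℝ => x ^ k) (P n))
    (hv : ∀ n, 1 ≤ n → 0 < mom (P n) 2)
    (hA : ∀ b, 1 ≤ b → Tendsto (fun n => normMom (P n) n b) atTop (𝓝 (A b)))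
    (hm : Tendsto (fun n : ℕ => (m n : ℝ) / (n : ℝ)) atTop (𝓝 α))
    (hlaw : ∀ n, 1 ≤ n → ∀ i j, HasLaw (fun ω => X n ω i j) (P n) (Pr n))
    (hind : ∀ n, 1 ≤ n →
      iIndepFun (fun (p : Fin n × Fin (m n)) (ω : Ω n) => X n ω p.1 p.2) (Pr n)) (K : ℕ) :
    Tendsto (fun n => variance (fun ω => mom (spectralMeasure
      (wishart_isHermitian (mom (P n) 2) (X n ω))) (K + 1)) (Pr n)) atTop (𝓝 0) := by
  have key := tendsto_finsetSum (Finset.univ : Finset (Setoid (Fin (K + 1) ⊕ Fin (K + 1))))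
    fun π _ => tendsto_finsetSum (Finset.univ : Finset (Setoid (Fin (K + 1) ⊕ Fin (K + 1))))
      fun ρ _ => tendsto_kernelCov hα hP hv hA hm π ρ
  simp only [Finset.sum_const_zero] at key
  refine key.congr' ?_
  filter_upwards [eventually_ge_atTop 1] with n hn
  have := hP n hn
  exact (variance_mom_eq_sum_kernels _ K (hint n hn) (hlaw n hn) (hind n hn)).symm

/-- The moments of the spectral measure converge in probability. -/
theorem tendsto_measure_abs_mom_sub (hα : 0 < α) {Ω : ℕ → Type*} [∀ n, MeasurableSpace (Ω n)]
    {Pr : ∀ n, Measure (Ω n)} [∀ n, IsProbabilityMeasure (Pr n)]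
    {X : ∀ n, Ω n → Matrix (Fin n) (Fin (m n)) ℝ}
    (hP : ∀ n, 1 ≤ n → IsProbabilityMeasure (P n))
    (hint : ∀ n, 1 ≤ n → ∀ k : ℕ, Integrable (fun x : ℝ => x ^ k) (P n))
    (hv : ∀ n, 1 ≤ n → 0 < mom (P n) 2)
    (hA : ∀ b, 1 ≤ b → Tendsto (fun n => normMom (P n) n b) atTop (𝓝 (A b)))
    (hm : Tendsto (fun n : ℕ => (m n : ℝ) / (n : ℝ)) atTop (𝓝 α))
    (hlaw : ∀ n, 1 ≤ n → ∀ i j, HasLaw (fun ω => X n ω i j) (P n) (Pr n))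
    (hind : ∀ n, 1 ≤ n →
      iIndepFun (fun (p : Fin n × Fin (m n)) (ω : Ω n) => X n ω p.1 p.2) (Pr n)) (K : ℕ)
    {δ : ℝ} (hδ : 0 < δ) :
    Tendsto (fun n => Pr n {ω | δ ≤ |mom (spectralMeasure
      (wishart_isHermitian (mom (P n) 2) (X n ω))) (K + 1) - kernelSum A α K|}) atTop (𝓝 0) := by
  have hE := tendsto_integral_mom hα hP hint hv hA hm hlaw hind K
  have hV := tendsto_variance_mom hα hP hint hv hA hm hlaw hind K
  have hlim : Tendsto (fun n => ENNReal.ofReal (variance (fun ω => mom (spectralMeasure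
      (wishart_isHermitian (mom (P n) 2) (X n ω))) (K + 1)) (Pr n) / (δ / 2) ^ 2))
      atTop (𝓝 0) := by
    have := (ENNReal.continuous_ofReal.tendsto _).comp (hV.div_const ((δ / 2) ^ 2))
    rwa [zero_div, ENNReal.ofReal_zero] at this
  refine tendsto_of_tendsto_of_tendsto_of_le_of_le' tendsto_const_nhds hlim
    (Eventually.of_forall fun _ => zero_le) ?_
  -- Half of `δ` absorbs the distance from the mean to its limit; Chebyshev's inequality is applied
  -- with the other half.
  filter_upwards [eventually_ge_atTop 1,
    (Metric.tendsto_nhds.1 hE) (δ / 2) (by positivity)] with n hn hEn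
  have := hP n hn
  refine le_trans (measure_mono ?_) (meas_ge_le_variance_div_sq
    (memLp_mom_spectralMeasure (mom (P n) 2) K (hint n hn) (hlaw n hn) (hind n hn))
    (by positivity : 0 < δ / 2))
  intro ω hω
  simp only [Set.mem_ofPred_eq] at hω ⊢
  rw [Real.dist_eq] at hEn
  have := abs_sub_le (mom (spectralMeasure (wishart_isHermitian (mom (P n) 2) (X n ω))) (K + 1))
    (∫ ω, mom (spectralMeasure (wishart_isHermitian (mom (P n) 2) (X n ω))) (K + 1) ∂(Pr n))
    (kernelSum A α K)
  linarith

end limit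

/-! ### Rooted trees -/

section trees

variable {V : Type*} {G : SimpleGraph V}

theorem exists_adj_dist_eq_add_one (hG : G.IsTree) {r v : V} (hv : v ≠ r) :
    ∃ u, G.Adj u v ∧ G.dist r v = G.dist r u + 1 := by
  obtain ⟨p, hp⟩ := hG.connected.exists_walk_length_eq_dist v r
  cases p with
  | nil => exact absurd rfl hv
  | @cons _ u _ h q =>
    refine ⟨u, h.symm, ?_⟩
    rw [SimpleGraph.Walk.length_cons] at hp
    have h1 := G.dist_le q
    rw [G.dist_comm] at hp h1
    rcases hG.dist_eq_dist_add_one_of_adj r h with h2 | h2 <;> omega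

theorem exists_far_vertex (hG : G.IsTree) (r : V) (e : G.edgeSet) :
    ∃ v, ∃ u, (e : Sym2 V) = s(u, v) ∧ G.dist r v = G.dist r u + 1 := by
  obtain ⟨e, he⟩ := e
  induction e using Sym2.ind with
  | _ u v =>
    rcases hG.dist_eq_dist_add_one_of_adj r he with h | h
    · exact ⟨u, v, Sym2.eq_swap, h⟩
    · exact ⟨v, u, rfl, h⟩

/-- The endpoint of an edge that is farther from the root. -/
def farEnd (hG : G.IsTree) (r : V) (e : G.edgeSet) : V := (exists_far_vertex hG r e).choose

theorem farEnd_eq (hG : G.IsTree) {r u v : V} (h : G.Adj u v)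
    (hd : G.dist r v = G.dist r u + 1) : farEnd hG r ⟨s(u, v), h⟩ = v := by
  obtain ⟨u', h1, h2⟩ := (exists_far_vertex hG r ⟨s(u, v), h⟩).choose_spec
  change s(u, v) = s(u', farEnd hG r ⟨s(u, v), h⟩) at h1
  change G.dist r (farEnd hG r ⟨s(u, v), h⟩) = _ at h2
  rcases Sym2.eq_iff.1 h1 with ⟨rfl, h4⟩ | ⟨h3, rfl⟩
  · exact h4.symm
  · rw [← h3] at h2
    omega

theorem exists_eq_farEnd (hG : G.IsTree) (r : V) (e : G.edgeSet) :
    ∃ u, (e : Sym2 V) = s(u, farEnd hG r e) ∧ G.dist r (farEnd hG r e) = G.dist r u + 1 :=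
  (exists_far_vertex hG r e).choose_spec

theorem farEnd_ne (hG : G.IsTree) (r : V) (e : G.edgeSet) : farEnd hG r e ≠ r := by
  obtain ⟨u, -, h⟩ := exists_eq_farEnd hG r e
  intro h0
  rw [h0, SimpleGraph.dist_self] at h
  omega

/-- Every vertex other than the root has a neighbour closer to the root, which gives surjectivity;
injectivity follows because a tree has one edge fewer than vertices. -/
theorem farEnd_bijective [Finite V] (hG : G.IsTree) (r : V) :
    Function.Bijective
      (fun e : G.edgeSet => (⟨farEnd hG r e, farEnd_ne hG r e⟩ : {v // v ≠ r})) := by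
  classical
  have := Fintype.ofFinite V
  have := Fintype.ofFinite G.edgeSet
  rw [Fintype.bijective_iff_surjective_and_card]
  constructor
  · rintro ⟨v, hv⟩
    obtain ⟨u, hu, hd⟩ := exists_adj_dist_eq_add_one hG hv
    exact ⟨⟨s(u, v), hu⟩, Subtype.ext (farEnd_eq hG hu hd)⟩
  · have h := (SimpleGraph.isTree_iff_connected_and_card.1 hG).2
    rw [Nat.card_eq_fintype_card, Nat.card_eq_fintype_card] at h
    have h2 : Fintype.card {v : V // v ≠ r} = Fintype.card V - 1 := by
      rw [Fintype.card_subtype_compl, Fintype.card_subtype_eq]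
    omega

/-- Every vertex of a finite tree has at most one parent. -/
theorem parent_unique [Finite V] (hG : G.IsTree) {r u u' v : V} (h : G.Adj u v)
    (hd : G.dist r v = G.dist r u + 1) (h' : G.Adj u' v) (hd' : G.dist r v = G.dist r u' + 1) :
    u = u' := by
  have h1 := (farEnd_bijective hG r).1 (a₁ := ⟨s(u, v), h⟩) (a₂ := ⟨s(u', v), h'⟩)
    (Subtype.ext ((farEnd_eq hG h hd).trans (farEnd_eq hG h' hd').symm))
  have h2 := congrArg Subtype.val h1
  rcases Sym2.eq_iff.1 h2 with ⟨h3, -⟩ | ⟨rfl, h4⟩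
  · exact h3
  · exact h4

/-- The odd edges correspond to the vertices at odd distance from the root. -/
theorem ncard_oddEdges [Finite V] (T : PlanarTree V) :
    T.oddEdges.ncard = Nat.card {v : V // Odd (T.graph.dist T.root v)} := by
  rw [← Nat.card_coe_set_eq]
  have hmem : ∀ e : T.graph.edgeSet, (e : Sym2 V) ∈ T.oddEdges ↔
      Odd (T.graph.dist T.root (farEnd T.isTree T.root e)) := by
    intro e
    obtain ⟨u, hu, hd⟩ := exists_eq_farEnd T.isTree T.root e
    constructor
    · rintro ⟨-, v, hv, hodd, hmax⟩
      rw [hu] at hv hmax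
      have h1 := hmax (farEnd T.isTree T.root e) (Sym2.mem_mk_right _ _)
      rcases Sym2.mem_iff.1 hv with rfl | rfl
      · omega
      · exact hodd
    · intro hodd
      refine ⟨e.2, farEnd T.isTree T.root e, by rw [hu]; exact Sym2.mem_mk_right _ _, ?_, ?_⟩
      · exact hodd
      · intro w hw
        rw [hu] at hw
        rcases Sym2.mem_iff.1 hw with rfl | rfl
        · exact hd.symm ▸ Nat.le_succ _
        · exact le_rfl
  let F : T.oddEdges → {v : V // Odd (T.graph.dist T.root v)} := fun e =>
    ⟨farEnd T.isTree T.root ⟨e.1, e.2.1⟩, (hmem ⟨e.1, e.2.1⟩).1 e.2⟩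
  refine Nat.card_congr (Equiv.ofBijective F ⟨?_, ?_⟩)
  · intro e e' h
    have h1 := (farEnd_bijective T.isTree T.root).1 (a₁ := ⟨e.1, e.2.1⟩) (a₂ := ⟨e'.1, e'.2.1⟩)
      (Subtype.ext (Subtype.mk.inj h))
    exact Subtype.ext (Subtype.mk.inj h1)
  · rintro ⟨v, hv⟩
    have hne : v ≠ T.root := by
      rintro rfl
      simp at hv
    obtain ⟨e, he⟩ := (farEnd_bijective T.isTree T.root).2 ⟨v, hne⟩
    have he' : farEnd T.isTree T.root e = v := congrArg Subtype.val he
    refine ⟨⟨e, (hmem e).2 (by rw [he']; exact hv)⟩, Subtype.ext he'⟩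

end trees

/-! ### Closed words on trees and kernels -/

/-- The closed alternating word `x₀ y₀ x₁ y₁ ⋯ x_K y_K x₀`. -/
def altWord {K : ℕ} {α β : Type*} (x : Fin (K + 1) → α) (y : Fin (K + 1) → β)
    (j : Fin (2 * (K + 1) + 1)) : α ⊕ β :=
  if (j : ℕ) % 2 = 0 then Sum.inl (x (Fin.ofNat (K + 1) (j / 2)))
  else Sum.inr (y (Fin.ofNat (K + 1) (j / 2)))

/-- The position of the `t`-th row letter. -/
def evenPos {K : ℕ} (t : Fin (K + 1)) : Fin (2 * (K + 1) + 1) := ⟨2 * t, by omega⟩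

/-- The position of the `t`-th column letter. -/
def oddPos {K : ℕ} (t : Fin (K + 1)) : Fin (2 * (K + 1) + 1) := ⟨2 * t + 1, by omega⟩

/-- The steps of a word of length `2 (K + 1)`, split by parity. -/
def stepEquiv (K : ℕ) : Fin (2 * (K + 1)) ≃ Fin (K + 1) × Bool where
  toFun j := (⟨j / 2, by omega⟩, decide ((j : ℕ) % 2 = 1))
  invFun p := ⟨2 * p.1 + p.2.toNat, by rcases p with ⟨t, _ | _⟩ <;> simp <;> omega⟩
  left_inv j := by
    ext
    rcases Nat.mod_two_eq_zero_or_one j with h | h <;> simp [h] <;> omega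
  right_inv p := by
    rcases p with ⟨t, _ | _⟩
    · simp
    · ext
      · simp; omega
      · simp

section altWord

variable {K : ℕ} {α β : Type*} (x : Fin (K + 1) → α) (y : Fin (K + 1) → β)

theorem altWord_of_eq_two_mul {j : Fin (2 * (K + 1) + 1)} {t : ℕ} (h : (j : ℕ) = 2 * t) :
    altWord x y j = Sum.inl (x (Fin.ofNat (K + 1) t)) := by
  rw [altWord, if_pos (by omega)]
  congr 3
  omega

theorem altWord_of_eq_two_mul_add_one {j : Fin (2 * (K + 1) + 1)} {t : ℕ}
    (h : (j : ℕ) = 2 * t + 1) : altWord x y j = Sum.inr (y (Fin.ofNat (K + 1) t)) := by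
  rw [altWord, if_neg (by omega)]
  congr 3
  omega

theorem ofNat_val_eq (t : Fin (K + 1)) : Fin.ofNat (K + 1) t = t := by
  ext
  simp

/-- On the left the addition is in `ℕ`, followed by reduction; on the right it is cyclic. At the
last index both sides are `0`, which closes the word. -/
theorem ofNat_val_add_one (t : Fin (K + 1)) : Fin.ofNat (K + 1) (t + 1) = t + 1 := by
  ext
  simp [Fin.val_add]

theorem altWord_evenPos (t : Fin (K + 1)) : altWord x y (evenPos t) = Sum.inl (x t) := by
  rw [altWord_of_eq_two_mul x y (t := t) rfl, ofNat_val_eq]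

theorem altWord_oddPos (t : Fin (K + 1)) : altWord x y (oddPos t) = Sum.inr (y t) := by
  rw [altWord_of_eq_two_mul_add_one x y (t := t) rfl, ofNat_val_eq]

theorem altWord_zero : altWord x y 0 = Sum.inl (x 0) := altWord_evenPos x y 0

theorem altWord_last : altWord x y (Fin.last _) = Sum.inl (x 0) := by
  rw [altWord_of_eq_two_mul x y (t := K + 1) (by simp)]
  congr 2
  ext
  simp

theorem altWord_step (j : Fin (2 * (K + 1))) :
    s(altWord x y j.castSucc, altWord x y j.succ) =
      s(Sum.inl (steps x y (stepEquiv K j)).1, Sum.inr (steps x y (stepEquiv K j)).2) := by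
  obtain ⟨p, rfl⟩ := (stepEquiv K).symm.surjective j
  rw [Equiv.apply_symm_apply]
  rcases p with ⟨t, _ | _⟩
  · rw [altWord_of_eq_two_mul x y (t := t) (by simp [stepEquiv]),
      altWord_of_eq_two_mul_add_one x y (t := t) (by simp [stepEquiv]), ofNat_val_eq]
    rfl
  · rw [altWord_of_eq_two_mul_add_one x y (t := t) (by simp [stepEquiv]),
      altWord_of_eq_two_mul x y (t := t + 1) (by simp [stepEquiv]; ring), ofNat_val_eq,
      ofNat_val_add_one, Sym2.eq_swap]
    rfl

theorem altWord_adj (j : Fin (2 * (K + 1))) :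
    (bipGraph (Set.range (steps x y))).Adj (altWord x y j.castSucc) (altWord x y j.succ) := by
  rw [← SimpleGraph.mem_edgeSet, altWord_step]
  exact ⟨stepEquiv K j, rfl⟩

theorem browseCount_altWord (a : α) (b : β) :
    browseCount (altWord x y) s(Sum.inl a, Sum.inr b) = mult (steps x y) (a, b) := by
  rw [browseCount, mult]
  refine Nat.card_congr ((stepEquiv K).subtypeEquiv fun j => ?_)
  rw [altWord_step]
  simp [Prod.ext_iff]

theorem browseCount_map {V V' : Type*} {N : ℕ} (w : Fin (N + 1) → V) {f : V → V'}
    (hf : Function.Injective f) (e : Sym2 V) : browseCount (f ∘ w) (e.map f) = browseCount w e := by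
  rw [browseCount, browseCount]
  refine Nat.card_congr (Equiv.subtypeEquivRight fun j => ?_)
  rw [← (Sym2.map.injective hf).eq_iff]
  simp

/-- Every word whose last letter equals its first is determined by its letters at even and odd
positions. -/
theorem eq_elim_altWord {V : Type*} {w : Fin (2 * (K + 1) + 1) → V}
    (hw : w (Fin.last _) = w 0) (j : Fin (2 * (K + 1) + 1)) :
    w j = Sum.elim id id (altWord (w ∘ evenPos) (w ∘ oddPos) j) := by
  rcases Nat.even_or_odd' j with ⟨t, h | h⟩
  · rw [altWord_of_eq_two_mul _ _ h]
    simp only [Sum.elim_inl, id, Function.comp_apply]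
    by_cases ht : t = K + 1
    · have h1 : j = Fin.last _ := by ext; simp; omega
      have h2 : evenPos (Fin.ofNat (K + 1) t) = 0 := by
        subst ht; ext; simp [evenPos]
      rw [h1, h2, hw]
    · congr 1
      ext
      have : t % (K + 1) = t := Nat.mod_eq_of_lt (by omega)
      simp [evenPos, this, h]
  · rw [altWord_of_eq_two_mul_add_one _ _ h]
    simp only [Sum.elim_inr, id, Function.comp_apply]
    congr 1
    ext
    have : t % (K + 1) = t := Nat.mod_eq_of_lt (by omega)
    simp [oddPos, this, h]

end altWord

/-! ### Words on trees and the graphs of their kernels. -/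

section correspondence

variable {K : ℕ} {V : Type*} {π ρ : Setoid (Fin (K + 1))}

/-- The word formed by the classes of its positions. -/
def quotWord (π ρ : Setoid (Fin (K + 1))) : Fin (2 * (K + 1) + 1) → Quotient π ⊕ Quotient ρ :=
  altWord (Quotient.mk π) (Quotient.mk ρ)

/-- The graph of the word formed by the classes of its positions. -/
def quotGraph (π ρ : Setoid (Fin (K + 1))) : SimpleGraph (Quotient π ⊕ Quotient ρ) :=
  bipGraph (Set.range (quotSteps π ρ))

theorem quotGraph_connected (π ρ : Setoid (Fin (K + 1))) : (quotGraph π ρ).Connected :=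
  connected_steps Quotient.mk_surjective Quotient.mk_surjective

theorem quotGraph_isTree_iff (π ρ : Setoid (Fin (K + 1))) : (quotGraph π ρ).IsTree ↔
    Nat.card (Quotient π) + Nat.card (Quotient ρ) = (values (quotSteps π ρ)).card + 1 := by
  rw [SimpleGraph.isTree_iff_connected_and_card, and_iff_right (quotGraph_connected π ρ),
    Nat.card_sum, values_card, quotGraph, ← Nat.card_congr (bipGraphEdges _), eq_comm]

/-- Along an edge the distance to the root changes parity and the vertex passes between rows and
columns, so the equivalence propagates along walks from the root, which is a row vertex. -/
theorem odd_dist_iff {T : PlanarTree V} (I : quotGraph π ρ ≃g T.graph)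
    (hroot : T.root = I (Sum.inl (Quotient.mk π 0))) (u : Quotient π ⊕ Quotient ρ) :
    Odd (T.graph.dist T.root (I u)) ↔ u.isRight := by
  have key : ∀ {a b : Quotient π ⊕ Quotient ρ} (_ : (quotGraph π ρ).Walk a b),
      (Odd (T.graph.dist T.root (I a)) ↔ a.isRight) →
        (Odd (T.graph.dist T.root (I b)) ↔ b.isRight) := by
    intro a b p
    induction p with
    | nil => exact id
    | @cons a c b h p ih =>
      intro ha
      refine ih ?_
      have hd := T.isTree.dist_eq_dist_add_one_of_adj T.root (I.map_adj_iff.2 h)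
      have hflip : c.isRight = !a.isRight := by
        rcases a with a | a <;> rcases c with c | c
        · exact False.elim h
        · rfl
        · rfl
        · exact False.elim h
      rw [hflip]
      cases hr : a.isRight
      · rw [hr] at ha
        simp only [Bool.false_eq_true, iff_false, Nat.not_odd_iff_even] at ha
        simp only [Bool.not_false, iff_true]
        rcases hd with hd | hd
        · rw [hd] at ha; simpa [Nat.even_add_one] using ha
        · rw [hd]; exact ha.add_one
      · rw [hr] at ha
        simp only [iff_true] at ha
        simp only [Bool.not_true, Bool.false_eq_true, iff_false, Nat.not_odd_iff_even]
        rcases hd with hd | hd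
        · rw [hd] at ha; simpa [Nat.odd_add_one] using ha
        · rw [hd]; exact ha.add_one
  obtain ⟨p⟩ := (quotGraph_connected π ρ).preconnected (Sum.inl (Quotient.mk π 0)) u
  refine key p ?_
  rw [← hroot]
  simp

theorem ncard_oddEdges_of_iso [Finite V] {T : PlanarTree V} (I : quotGraph π ρ ≃g T.graph)
    (hroot : T.root = I (Sum.inl (Quotient.mk π 0))) :
    T.oddEdges.ncard = Nat.card (Quotient ρ) := by
  rw [ncard_oddEdges]
  symm
  refine Nat.card_congr (Equiv.ofBijective
    (fun q => ⟨I (Sum.inr q), (odd_dist_iff I hroot _).2 rfl⟩) ⟨?_, ?_⟩)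
  · intro q q' h
    exact Sum.inr_injective (I.injective (Subtype.mk.inj h))
  · rintro ⟨v, hv⟩
    obtain ⟨u, rfl⟩ := I.surjective v
    rw [odd_dist_iff I hroot] at hv
    rcases u with q | q
    · simp at hv
    · exact ⟨q, rfl⟩

/-- The multiplicities of the values of `f` are `b₁, …, b_a`, in some order. -/
def HasMults {T S : Type*} {a : ℕ} (f : T → S) (b : Fin a → ℕ) : Prop :=
  ∃ e : Fin a ≃ Set.range f, ∀ i, mult f (e i) = b i

theorem hasBrowseCounts_iff {T : PlanarTree V} {w : Fin (2 * (K + 1) + 1) → V}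
    (I : quotGraph π ρ ≃g T.graph) (hw : w = I ∘ quotWord π ρ) {a : ℕ} (b : Fin a → ℕ) :
    HasBrowseCounts T w b ↔ HasMults (quotSteps π ρ) b := by
  let E : Set.range (quotSteps π ρ) ≃ T.graph.edgeSet :=
    (bipGraphEdges (Set.range (quotSteps π ρ))).trans I.mapEdgeSet
  have hE : ∀ p, browseCount w (E p : Sym2 V) = mult (quotSteps π ρ) p := by
    intro p
    have h1 : (E p : Sym2 V) = Sym2.map I s(Sum.inl p.1.1, Sum.inr p.1.2) := rfl
    rw [h1, hw, browseCount_map _ I.injective]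
    exact browseCount_altWord _ _ _ _
  constructor
  · rintro ⟨e, he⟩
    refine ⟨e.trans E.symm, fun i => ?_⟩
    rw [← he, ← hE]
    simp
  · rintro ⟨e, he⟩
    exact ⟨e.trans E, fun i => by rw [← he, ← hE]; rfl⟩

/-- The kernels of the row and the column letters of a word. -/
def kernels (w : Fin (2 * (K + 1) + 1) → V) : Setoid (Fin (K + 1)) × Setoid (Fin (K + 1)) :=
  (Setoid.ker (w ∘ evenPos), Setoid.ker (w ∘ oddPos))

theorem kernels_comp {V' : Type*} {f : V → V'} (hf : Function.Injective f)
    (w : Fin (2 * (K + 1) + 1) → V) : kernels (f ∘ w) = kernels w := by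
  unfold kernels
  congr 1 <;> ext a b <;> simp [Setoid.ker_def, hf.eq_iff]

theorem kernels_quotWord (π ρ : Setoid (Fin (K + 1))) : kernels (quotWord π ρ) = (π, ρ) := by
  unfold kernels
  congr 1
  · ext a b
    simp [Setoid.ker_def, quotWord, altWord_evenPos, Quotient.eq]
  · ext a b
    simp [Setoid.ker_def, quotWord, altWord_oddPos, Quotient.eq]

theorem even_dist_of_isClosedWord {N : ℕ} {T : PlanarTree V} {w : Fin (N + 1) → V}
    (h : IsClosedWord T w) (j : Fin (N + 1)) :
    Even (T.graph.dist T.root (w j)) ↔ Even (j : ℕ) := by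
  induction j using Fin.induction with
  | zero => simp [h.start]
  | succ j ih =>
    have hd := T.isTree.dist_eq_dist_add_one_of_adj T.root (h.adj j)
    rw [Fin.val_castSucc] at ih
    rw [Fin.val_succ, Nat.even_add_one, ← ih]
    rcases hd with hd | hd <;> rw [hd] <;> simp [Nat.even_add_one]

/-- A closed word that browses all the edges of a tree is, up to a bijection of the letters, the
word formed by the classes of its positions. -/
theorem exists_iso_of_isClosedWord [Nontrivial V] {T : PlanarTree V}
    {w : Fin (2 * (K + 1) + 1) → V} (h : IsClosedWord T w)
    (hb : ∀ e ∈ T.graph.edgeSet, 0 < browseCount w e) :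
    ∃ I : quotGraph (kernels w).1 (kernels w).2 ≃g T.graph,
      w = I ∘ quotWord (kernels w).1 (kernels w).2 := by
  set φ : Quotient (kernels w).1 ⊕ Quotient (kernels w).2 → V :=
    Sum.elim (Setoid.kerLift (w ∘ evenPos)) (Setoid.kerLift (w ∘ oddPos))
  have hw : w = φ ∘ quotWord (kernels w).1 (kernels w).2 := by
    funext j
    refine (eq_elim_altWord h.closed j).trans ?_
    rw [Function.comp_apply, quotWord, altWord, altWord]
    split_ifs <;> rfl
  -- Row letters lie at even distance from the root and column letters at odd distance. Hence two
  -- kernels, one for each parity, lose no coincidence of letters.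
  have hne : ∀ t t' : Fin (K + 1), w (evenPos t) ≠ w (oddPos t') := by
    intro t t' heq
    have h1 := (even_dist_of_isClosedWord h (evenPos t)).2 (even_two_mul _)
    rw [heq, even_dist_of_isClosedWord h] at h1
    exact absurd h1 (by simp [oddPos])
  have hinj : Function.Injective φ := by
    rintro (q | q) (q' | q') heq
    · exact congrArg Sum.inl (Setoid.kerLift_injective _ heq)
    · obtain ⟨t, rfl⟩ := Quotient.mk_surjective q
      obtain ⟨t', rfl⟩ := Quotient.mk_surjective q'
      exact absurd heq (hne t t')
    · obtain ⟨t, rfl⟩ := Quotient.mk_surjective q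
      obtain ⟨t', rfl⟩ := Quotient.mk_surjective q'
      exact absurd heq.symm (hne t' t)
    · exact congrArg Sum.inr (Setoid.kerLift_injective _ heq)
  have hbrowse : ∀ {u v : V}, T.graph.Adj u v →
      ∃ j : Fin (2 * (K + 1)), s(w j.castSucc, w j.succ) = s(u, v) := by
    intro u v huv
    have := hb s(u, v) huv
    rw [browseCount, Nat.card_pos_iff] at this
    obtain ⟨⟨j, hj⟩⟩ := this.1
    exact ⟨j, hj⟩
  -- In a nontrivial tree each vertex lies on an edge, and that edge is browsed.
  have hsurj : Function.Surjective φ := by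
    intro v
    have hdeg : ∃ u, T.graph.Adj v u := T.isTree.connected.preconnected.exists_adj_of_nontrivial v
    obtain ⟨u, hu⟩ := hdeg
    obtain ⟨j, hj⟩ := hbrowse hu
    rcases Sym2.eq_iff.1 hj with ⟨h1, -⟩ | ⟨-, h1⟩
    · exact ⟨_, (congrFun hw j.castSucc).symm.trans h1⟩
    · exact ⟨_, (congrFun hw j.succ).symm.trans h1⟩
  refine ⟨⟨Equiv.ofBijective φ ⟨hinj, hsurj⟩, ?_⟩, hw⟩
  intro a b
  change T.graph.Adj (φ a) (φ b) ↔ _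
  have hstep : ∀ j : Fin (2 * (K + 1)), s(w j.castSucc, w j.succ) =
      Sym2.map φ s(quotWord (kernels w).1 (kernels w).2 j.castSucc,
        quotWord (kernels w).1 (kernels w).2 j.succ) := by
    intro j
    rw [Sym2.map_mk]
    conv_lhs => rw [hw]
    rfl
  constructor
  · intro hab
    obtain ⟨j, hj⟩ := hbrowse hab
    have hj' := Sym2.map.injective hinj ((hstep j).symm.trans hj : _ = Sym2.map φ s(a, b))
    rw [← SimpleGraph.mem_edgeSet, ← hj']
    exact altWord_adj _ _ j
  · intro hab
    obtain ⟨⟨p, hp⟩, hpe⟩ := (bipGraphEdges _).surjective ⟨s(a, b), hab⟩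
    obtain ⟨t, rfl⟩ := hp
    have h1 := congrArg Subtype.val hpe
    rw [bipGraphEdges_apply] at h1
    change _ = s(a, b) at h1
    have h2 := altWord_step (Quotient.mk (kernels w).1) (Quotient.mk (kernels w).2)
      ((stepEquiv K).symm t)
    rw [Equiv.apply_symm_apply] at h2
    have h3 := h.adj ((stepEquiv K).symm t)
    rw [← SimpleGraph.mem_edgeSet, hstep] at h3
    rw [quotWord, h2] at h3
    change Sym2.map φ s(a, b) ∈ T.graph.edgeSet
    rw [← h1]
    exact h3

end correspondence

/-! ### The moment formula -/

/-- The pairs of kernels whose graph is a tree with `a` edges and `l` column vertices, the edges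
having multiplicities `b₁, …, b_a`. -/
def treeKernels (K a l : ℕ) (b : Fin a → ℕ) : Set (Setoid (Fin (K + 1)) × Setoid (Fin (K + 1))) :=
  {z | (quotGraph z.1 z.2).IsTree ∧ Nat.card (Quotient z.2) = l ∧ HasMults (quotSteps z.1 z.2) b}

/-- The kernels of a class of words. -/
def classKernels {V : Type*} {K : ℕ} :
    Quotient (wordSetoid V (2 * (K + 1))) → Setoid (Fin (K + 1)) × Setoid (Fin (K + 1)) :=
  Quotient.lift kernels (by
    rintro w w' ⟨σ, h⟩
    rw [← kernels_comp σ.injective w]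
    congr 1
    funext j
    exact h j)

theorem exists_iso_of_hasBrowseCounts {K a : ℕ} (ha : 1 ≤ a) {b : Fin a → ℕ} (hb : ∀ i, 1 ≤ b i)
    {T : PlanarTree (Fin (a + 1))} {w : Fin (2 * (K + 1) + 1) → Fin (a + 1)}
    (h : IsClosedWord T w) (hc : HasBrowseCounts T w b) :
    ∃ I : quotGraph (kernels w).1 (kernels w).2 ≃g T.graph,
      w = I ∘ quotWord (kernels w).1 (kernels w).2 := by
  have : Nontrivial (Fin (a + 1)) := Fin.nontrivial_iff_two_le.2 (by omega)
  refine exists_iso_of_isClosedWord h fun e he => ?_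
  obtain ⟨E, hE⟩ := hc
  have := hE (E.symm ⟨e, he⟩)
  rw [Equiv.apply_symm_apply] at this
  rw [this]
  exact hb _

theorem root_eq_of_iso {K : ℕ} {V : Type*} {π ρ : Setoid (Fin (K + 1))} {T : PlanarTree V}
    {w : Fin (2 * (K + 1) + 1) → V} (h : IsClosedWord T w) {φ : Quotient π ⊕ Quotient ρ → V}
    (hw : w = φ ∘ quotWord π ρ) : T.root = φ (Sum.inl (Quotient.mk π 0)) := by
  rw [← h.start, hw, Function.comp_apply, quotWord, altWord_zero]

theorem exists_planarTree {K a : ℕ} {π ρ : Setoid (Fin (K + 1))} (h : (quotGraph π ρ).IsTree)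
    {b : Fin a → ℕ} (hb : HasMults (quotSteps π ρ) b) :
    ∃ (T : PlanarTree (Fin (a + 1))) (I : quotGraph π ρ ≃g T.graph),
      IsClosedWord T (I ∘ quotWord π ρ) := by
  have hcard : Nat.card (Quotient π ⊕ Quotient ρ) = a + 1 := by
    obtain ⟨e, -⟩ := hb
    rw [Nat.card_sum, (quotGraph_isTree_iff π ρ).1 h, values_card, ← Nat.card_congr e,
      Nat.card_fin]
  let φ : Quotient π ⊕ Quotient ρ ≃ Fin (a + 1) := Finite.equivFinOfCardEq hcard
  let I : quotGraph π ρ ≃g (quotGraph π ρ).map φ := SimpleGraph.Iso.map φ _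
  let T : PlanarTree (Fin (a + 1)) :=
    { graph := (quotGraph π ρ).map φ
      isTree := I.isTree_iff.1 h
      root := φ (Sum.inl (Quotient.mk π 0))
      -- Any order on the children will do, since equivalence of words ignores it; this one is
      -- inherited from `Fin (a + 1)`.
      childOrder := fun v => inferInstance }
  refine ⟨T, I, ?_, ?_, ?_⟩
  · intro j
    exact I.map_adj_iff.2 (altWord_adj _ _ j)
  · exact congrArg φ (altWord_zero _ _)
  · exact congrArg φ ((altWord_last _ _).trans (altWord_zero _ _).symm)

theorem image_wordClasses {K a l : ℕ} (ha : 1 ≤ a) {b : Fin a → ℕ} (hb : ∀ i, 1 ≤ b i) :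
    classKernels '' wordClasses (K + 1) a l b = treeKernels K a l b := by
  ext ⟨π, ρ⟩
  constructor
  · rintro ⟨c, ⟨T, w, hT, hl, hc, rfl⟩, hk⟩
    change kernels w = (π, ρ) at hk
    obtain ⟨I, hw⟩ := exists_iso_of_hasBrowseCounts ha hb hT hc
    have hroot := root_eq_of_iso hT hw
    rw [← hk]
    exact ⟨I.isTree_iff.2 T.isTree, by rw [← hl, ncard_oddEdges_of_iso I hroot],
      (hasBrowseCounts_iff I hw b).1 hc⟩
  · rintro ⟨htree, hl, hm⟩
    obtain ⟨T, I, hT⟩ := exists_planarTree htree hm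
    refine ⟨Quotient.mk _ (I ∘ quotWord π ρ), ⟨T, _, hT, ?_, ?_, rfl⟩, ?_⟩
    · rw [ncard_oddEdges_of_iso I (root_eq_of_iso hT rfl), hl]
    · exact (hasBrowseCounts_iff I rfl b).2 hm
    · change kernels (I ∘ quotWord π ρ) = _
      rw [kernels_comp I.injective, kernels_quotWord]

/-- Two words with the same kernels are images of the same word of classes under bijections onto the
labels; one bijection composed with the inverse of the other is the relabeling. -/
theorem injOn_classKernels {K a l : ℕ} (ha : 1 ≤ a) {b : Fin a → ℕ} (hb : ∀ i, 1 ≤ b i) :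
    Set.InjOn classKernels (wordClasses (K + 1) a l b) := by
  rintro _ ⟨T, w, hT, -, hc, rfl⟩ _ ⟨T', w', hT', -, hc', rfl⟩ heq
  change kernels w = kernels w' at heq
  obtain ⟨I, hw⟩ := exists_iso_of_hasBrowseCounts ha hb hT hc
  have h' := exists_iso_of_hasBrowseCounts ha hb hT' hc'
  rw [← heq] at h'
  obtain ⟨I', hw'⟩ := h'
  apply Quotient.sound
  refine ⟨I.toEquiv.symm.trans I'.toEquiv, fun j => ?_⟩
  rw [congrFun hw j, congrFun hw' j]
  exact congrArg I' (I.toEquiv.symm_apply_apply _)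

theorem ncard_wordClasses {K a l : ℕ} (ha : 1 ≤ a) {b : Fin a → ℕ} (hb : ∀ i, 1 ≤ b i) :
    (wordClasses (K + 1) a l b).ncard = (treeKernels K a l b).ncard := by
  rw [← image_wordClasses ha hb, (injOn_classKernels ha hb).ncard_image]

theorem prod_eq_multProd {T S : Type*} [Fintype T] {f : T → S} {a : ℕ} {b : Fin a → ℕ}
    (h : HasMults f b) (A : ℕ → ℝ) : ∏ i, A (b i) = multProd A f := by
  obtain ⟨e, he⟩ := h
  rw [multProd]
  refine Finset.prod_bij (fun i _ => (e i : S)) (fun i _ => mem_values.2 (e i).2) ?_ ?_ ?_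
  · intro i _ j _ hij
    exact e.injective (Subtype.ext hij)
  · intro p hp
    exact ⟨e.symm ⟨p, mem_values.1 hp⟩, Finset.mem_univ _, by simp⟩
  · intro i _
    rw [he]

theorem hasMults_card {T S : Type*} [Fintype T] {f : T → S} {a : ℕ} {b : Fin a → ℕ}
    (h : HasMults f b) : (values f).card = a := by
  obtain ⟨e, -⟩ := h
  rw [values_card, ← Nat.card_congr e, Nat.card_fin]

theorem hasMults_sum {T S : Type*} [Fintype T] {f : T → S} {a : ℕ} {b : Fin a → ℕ}
    (h : HasMults f b) : ∑ i, b i = Fintype.card T := by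
  obtain ⟨e, he⟩ := h
  rw [← sum_mult_values f]
  refine Finset.sum_bij (fun i _ => (e i : S)) (fun i _ => mem_values.2 (e i).2) ?_ ?_ ?_
  · intro i _ j _ hij
    exact e.injective (Subtype.ext hij)
  · intro p hp
    exact ⟨e.symm ⟨p, mem_values.1 hp⟩, Finset.mem_univ _, by simp⟩
  · intro i _
    rw [he]

theorem exists_antitone_hasMults {T S : Type*} [Fintype T] (f : T → S) :
    ∃ b : Fin (values f).card → ℕ, Antitone b ∧ HasMults f b := by
  let e : Fin (values f).card ≃ Set.range f :=
    (Finite.equivFinOfCardEq (values_card f).symm).symm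
  let g : Fin (values f).card → ℕ := fun i => mult f (e i)
  refine ⟨g ∘ Tuple.sort g ∘ Fin.rev, ?_, (Fin.revPerm.trans (Tuple.sort g)).trans e,
    fun i => rfl⟩
  exact (Tuple.monotone_sort g).comp_antitone Fin.rev_anti

theorem antitone_hasMults_unique {T S : Type*} {f : T → S} {a : ℕ} {b b' : Fin a → ℕ}
    (hb : Antitone b) (hb' : Antitone b') (h : HasMults f b) (h' : HasMults f b') : b = b' := by
  obtain ⟨e, he⟩ := h
  obtain ⟨e', he'⟩ := h'
  have h1 : b' = b ∘ (e'.trans e.symm : Equiv.Perm (Fin a)) := by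
    funext i
    rw [← he', Function.comp_apply, ← he]
    simp
  have := Tuple.unique_antitone (f := b) (σ := Equiv.refl _) (τ := e'.trans e.symm) hb
    (h1 ▸ hb')
  rw [h1, ← this]
  rfl

/-- A tree kernel whose multiplicities are all at least `2` occurs for exactly one triple `(a, l,
b)`: its numbers of edges and of column classes, and its sorted multiplicities. If some multiplicity
is `1` it occurs for none, and the right-hand side vanishes because `A 1 = 0`. -/
theorem sum_multiplicities_eq {K : ℕ} {A : ℕ → ℝ} {α : ℝ} (hA : A 1 = 0)
    (z : Setoid (Fin (K + 1)) × Setoid (Fin (K + 1)))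
    [∀ a l b, Decidable (z ∈ treeKernels K a l b)] :
    ∑ a ∈ Finset.Icc 1 (K + 1), ∑ l ∈ Finset.Icc 1 a, ∑ b ∈ multiplicities a (K + 1),
      (if z ∈ treeKernels K a l b then α ^ l * ∏ i, A (b i) else 0) =
    (if Nat.card (Quotient z.1) + Nat.card (Quotient z.2) = (values (quotSteps z.1 z.2)).card + 1
      then α ^ Nat.card (Quotient z.2) else 0) * multProd A (quotSteps z.1 z.2) := by
  obtain ⟨π, ρ⟩ := z
  simp only
  set f := quotSteps π ρ with hf
  by_cases htree : (quotGraph π ρ).IsTree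
  swap
  · rw [if_neg (fun h => htree ((quotGraph_isTree_iff π ρ).2 h)), zero_mul]
    refine Finset.sum_eq_zero fun a _ => Finset.sum_eq_zero fun l _ =>
      Finset.sum_eq_zero fun b _ => ?_
    exact if_neg fun h => htree h.1
  have hcard := (quotGraph_isTree_iff π ρ).1 htree
  rw [← hf] at hcard
  rw [if_pos hcard]
  obtain ⟨b₀, hb₀, hm₀⟩ := exists_antitone_hasMults f
  by_cases htwo : ∀ p ∈ values f, 2 ≤ mult f p
  swap
  · push Not at htwo
    obtain ⟨p, hp, hlt⟩ := htwo
    have hpos := mult_pos_iff.2 (mem_values.1 hp)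
    have h1 : mult f p = 1 := by omega
    have h0 : multProd A f = 0 := Finset.prod_eq_zero hp (by rw [h1, hA])
    rw [h0, mul_zero]
    refine Finset.sum_eq_zero fun a _ => Finset.sum_eq_zero fun l _ =>
      Finset.sum_eq_zero fun b hb => if_neg ?_
    rintro ⟨-, -, e, he⟩
    have h2 := he (e.symm ⟨p, mem_values.1 hp⟩)
    rw [Equiv.apply_symm_apply] at h2
    have h3 := (Finset.mem_filter.1 hb).2.2 (e.symm ⟨p, mem_values.1 hp⟩)
    change mult f p = _ at h2
    omega
  have hb₀two : ∀ i, 2 ≤ b₀ i := by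
    obtain ⟨e, he⟩ := hm₀
    intro i
    rw [← he]
    exact htwo _ (mem_values.2 (e i).2)
  have hsum : ∑ i, b₀ i = 2 * (K + 1) := by
    rw [hasMults_sum hm₀]
    simp
    ring
  have hle : (values f).card ≤ K + 1 := by
    have : ∑ i : Fin (values f).card, 2 ≤ ∑ i, b₀ i := Finset.sum_le_sum fun i _ => hb₀two i
    rw [hsum] at this
    simp at this
    omega
  -- The classes number `a + 1` in all, for `a` edges; as each kind occurs, `1 ≤ l ≤ a`, which puts
  -- `l` and `a` in the ranges of summation.
  have hπ : 1 ≤ Nat.card (Quotient π) := Nat.card_pos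
  have hρ : 1 ≤ Nat.card (Quotient ρ) := Nat.card_pos
  have hmem₀ : b₀ ∈ multiplicities (values f).card (K + 1) := by
    rw [multiplicities, Finset.mem_filter, Finset.mem_piAntidiag]
    exact ⟨⟨hsum, fun i _ => Finset.mem_univ i⟩, hb₀, hb₀two⟩
  rw [Finset.sum_eq_single (values f).card, Finset.sum_eq_single (Nat.card (Quotient ρ)),
    Finset.sum_eq_single b₀, if_pos ⟨htree, rfl, hm₀⟩, prod_eq_multProd hm₀]
  · intro b hb hne
    refine if_neg ?_
    rintro ⟨-, -, hm⟩
    exact hne (antitone_hasMults_unique (Finset.mem_filter.1 hb).2.1 hb₀ hm hm₀)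
  · exact fun h => absurd hmem₀ h
  · intro l _ hne
    exact Finset.sum_eq_zero fun b _ => if_neg fun h => hne h.2.1.symm
  · intro h
    exact absurd (Finset.mem_Icc.2 ⟨hρ, by omega⟩) h
  · intro a _ hne
    exact Finset.sum_eq_zero fun l _ => Finset.sum_eq_zero fun b _ => if_neg fun h =>
      hne (hasMults_card h.2.2).symm
  · intro h
    exact absurd (Finset.mem_Icc.2 ⟨by omega, hle⟩) h

/-- The sum over the pairs of kernels is the right-hand side of the moment formula. -/
theorem kernelSum_eq_limitMoment {A : ℕ → ℝ} (hA : A 1 = 0) (α : ℝ) (K : ℕ) :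
    kernelSum A α K = limitMoment A α (K + 1) := by
  classical
  rw [kernelSum, ← Fintype.sum_prod_type' (f := fun (π ρ : Setoid (Fin (K + 1))) =>
    (if Nat.card (Quotient π) + Nat.card (Quotient ρ) = (values (quotSteps π ρ)).card + 1
      then α ^ Nat.card (Quotient ρ) else 0) * multProd A (quotSteps π ρ))]
  rw [Finset.sum_congr rfl fun z _ => (sum_multiplicities_eq hA z).symm, limitMoment,
    Finset.sum_comm]
  refine Finset.sum_congr rfl fun a ha => ?_
  rw [Finset.sum_comm]
  refine Finset.sum_congr rfl fun l _ => ?_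
  rw [Finset.sum_comm, Finset.mul_sum]
  refine Finset.sum_congr rfl fun b hb => ?_
  have hb2 := (Finset.mem_filter.1 hb).2.2
  rw [ncard_wordClasses (Finset.mem_Icc.1 ha).1 (fun i => le_trans one_le_two (hb2 i)),
    ← Finset.sum_filter, Finset.sum_const, nsmul_eq_mul, Set.ncard_eq_toFinset_card']
  rw [show (treeKernels K a l b).toFinset = Finset.univ.filter (· ∈ treeKernels K a l b) by
    ext; simp]
  ring

/-! ### Growth of the moments -/

/-- A word that moves in a rooted forest, with parent function `par` and height `h`: the steps in
`D` go away from the root, the others go to the parent. -/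
structure IsTreeWord {L : Type*} {N : ℕ} (w : Fin (N + 1) → L) (D : Finset (Fin N))
    (par : L → L) (h : L → ℕ) : Prop where
  start : h (w 0) = 0
  down : ∀ j ∈ D, par (w j.succ) = w j.castSucc ∧ h (w j.succ) = h (w j.castSucc) + 1
  up : ∀ j ∉ D, par (w j.castSucc) = w j.succ ∧ h (w j.castSucc) = h (w j.succ) + 1

namespace IsTreeWord

variable {L : Type*} {N : ℕ} {w w' : Fin (N + 1) → L} {D : Finset (Fin N)} {par par' : L → L}
  {h h' : L → ℕ}

/-- A vertex of positive height has been entered from its parent. If the word arrives there by an up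
step, the child it comes from was itself entered by an earlier down step, whose origin is the vertex
in question; strong induction on time concludes. -/
theorem exists_down (hw : IsTreeWord w D par h) (t : Fin (N + 1)) (ht : h (w t) ≠ 0) :
    ∃ j ∈ D, j.succ ≤ t ∧ w j.succ = w t := by
  induction t using WellFoundedLT.induction with
  | _ t ih =>
    induction t using Fin.cases with
    | zero => exact absurd hw.start ht
    | succ j =>
      by_cases hj : j ∈ D
      · exact ⟨j, hj, le_rfl, rfl⟩
      obtain ⟨h1, h2⟩ := hw.up j hj
      obtain ⟨i, hi, hij, hwi⟩ := ih j.castSucc j.castSucc_lt_succ (by omega)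
      have h3 : w i.castSucc = w j.succ := by rw [← (hw.down i hi).1, hwi, h1]
      have h4 : i.castSucc < j.succ :=
        (i.castSucc_lt_succ.trans_le hij).trans j.castSucc_lt_succ
      obtain ⟨i', hi', hij', hwi'⟩ := ih i.castSucc h4 (by rw [h3]; exact ht)
      exact ⟨i', hi', hij'.trans h4.le, hwi'.trans h3⟩

/-- A tree word is determined by its first letter, its down steps and their targets. -/
theorem eq_of_down (hw : IsTreeWord w D par h) (hw' : IsTreeWord w' D par' h')
    (h0 : w 0 = w' 0) (hD : ∀ j ∈ D, w j.succ = w' j.succ) : w = w' := by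
  funext t
  induction t using WellFoundedLT.induction with
  | _ t ih =>
    induction t using Fin.cases with
    | zero => exact h0
    | succ j =>
      by_cases hj : j ∈ D
      · exact hD j hj
      -- An up step leads to the parent of the current letter, and an earlier down step into that
      -- letter has already revealed this parent. So `par` and `par'` need not be compared directly.
      obtain ⟨h1, h2⟩ := hw.up j hj
      obtain ⟨i, hi, hij, hwi⟩ := hw.exists_down j.castSucc (by omega)
      have h4 : i.castSucc < j.succ :=
        (i.castSucc_lt_succ.trans_le hij).trans j.castSucc_lt_succ
      rw [← h1, ← (hw'.up j hj).1, ← ih j.castSucc j.castSucc_lt_succ, ← hwi,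
        (hw.down i hi).1, ih i.castSucc h4, hD i hi, (hw'.down i hi).1]

/-- Half of the steps of a closed tree word are down steps. -/
theorem two_mul_card (hw : IsTreeWord w D par h) (hc : w (Fin.last N) = w 0) :
    2 * D.card = N := by
  classical
  -- Heights telescope along the closed word: down steps count `+1`, up steps `-1`.
  have h1 := Fin.sum_univ_succ (fun t => (h (w t) : ℤ))
  rw [Fin.sum_univ_castSucc, hc, add_comm, add_left_cancel_iff, eq_comm, ← sub_eq_zero,
    ← Finset.sum_sub_distrib] at h1
  have h2 : ∀ j : Fin N, (h (w j.succ) : ℤ) - h (w j.castSucc) =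
      2 * (if j ∈ D then 1 else 0) - 1 := by
    intro j
    split_ifs with hj
    · rw [(hw.down j hj).2]; push_cast; ring
    · rw [(hw.up j hj).2]; push_cast; ring
  rw [Finset.sum_congr rfl fun j _ => h2 j, Finset.sum_sub_distrib, ← Finset.mul_sum] at h1
  simp at h1
  omega

end IsTreeWord

/-- An enumeration of the subsets of cardinality `K + 1`. -/
def enumFinset {K N : ℕ} [NeZero N] (D : Finset (Fin N)) : Fin (K + 1) → Fin N :=
  if hD : D.card = K + 1 then D.orderEmbOfFin hD else fun _ => 0

theorem exists_enumFinset_eq {K N : ℕ} [NeZero N] {D : Finset (Fin N)} (hD : D.card = K + 1)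
    {j : Fin N} (hj : j ∈ D) : ∃ i : Fin (K + 1), enumFinset D i = j := by
  rw [enumFinset, dif_pos hD]
  have h := Finset.range_orderEmbOfFin D hD
  have : j ∈ Set.range (D.orderEmbOfFin hD) := by rw [h]; exact hj
  exact this

/-- A family of closed tree words that determine its indices is not too large. -/
theorem card_le_of_isTreeWord {ι L : Type*} [Fintype L] {K : ℕ} (S : Finset ι)
    (w : ι → Fin (2 * (K + 1) + 1) → L) (hinj : Set.InjOn w S)
    (hw : ∀ z ∈ S, ∃ D par h, IsTreeWord (w z) D par h)
    (hc : ∀ z ∈ S, w z (Fin.last _) = w z 0) :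
    S.card ≤ Fintype.card L * (4 ^ (K + 1) * Fintype.card L ^ (K + 1)) := by
  classical
  choose! D par h hD using hw
  have hcard : ∀ z ∈ S, (D z).card = K + 1 := fun z hz => by
    have := (hD z hz).two_mul_card (hc z hz)
    omega
  -- The code of a word is its first letter, its set of down steps (one of `2 ^ (2 * (K + 1))`) and
  -- the targets of its `K + 1` down steps.
  have h1 : S.card ≤ (Finset.univ : Finset (L × Finset (Fin (2 * (K + 1))) ×
      (Fin (K + 1) → L))).card := by
    refine Finset.card_le_card_of_injOn
      (fun z => (w z 0, D z, fun i => w z (enumFinset (D z) i).succ))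
      (fun _ _ => by simp) ?_
    intro z hz z' hz' heq
    simp only [Prod.mk.injEq] at heq
    obtain ⟨h0, hDD, hf⟩ := heq
    have hz'D := hD z' hz'
    rw [← hDD] at hz'D hf
    refine hinj hz hz' ((hD z hz).eq_of_down hz'D h0 fun j hj => ?_)
    obtain ⟨i, rfl⟩ := exists_enumFinset_eq (hcard z hz) hj
    exact congrFun hf i
  refine h1.trans (le_of_eq ?_)
  rw [Finset.card_univ, Fintype.card_prod, Fintype.card_prod, Fintype.card_finset,
    Fintype.card_fin, Fintype.card_fun, Fintype.card_fin, pow_mul]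
  norm_num

/-- The word formed by the classes of its positions is a tree word if its graph is a tree. -/
theorem exists_isTreeWord {K : ℕ} {π ρ : Setoid (Fin (K + 1))} (hT : (quotGraph π ρ).IsTree)
    {L : Type*} {φ : Quotient π ⊕ Quotient ρ → L} (hφ : Function.Injective φ) :
    ∃ D par h, IsTreeWord (φ ∘ quotWord π ρ) D par h := by
  classical
  set G := quotGraph π ρ
  set u := quotWord π ρ
  set d : Quotient π ⊕ Quotient ρ → ℕ := G.dist (u 0)
  have hpar : ∃ par : Quotient π ⊕ Quotient ρ → Quotient π ⊕ Quotient ρ,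
      ∀ {a v}, G.Adj a v → d v = d a + 1 → par v = a := by
    refine ⟨fun v => if h : ∃ a, G.Adj a v ∧ d v = d a + 1 then h.choose else v, ?_⟩
    intro a v hav hd
    have hex : ∃ a, G.Adj a v ∧ d v = d a + 1 := ⟨a, hav, hd⟩
    simp only [dif_pos hex]
    exact parent_unique hT hex.choose_spec.1 hex.choose_spec.2 hav hd
  obtain ⟨par, hpar⟩ := hpar
  have hadj : ∀ j : Fin (2 * (K + 1)), G.Adj (u j.castSucc) (u j.succ) := fun j =>
    altWord_adj _ _ j
  -- Parent and height are transported to `L` along `φ`; their values off its range play no role.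
  refine ⟨Finset.univ.filter fun j => d (u j.succ) = d (u j.castSucc) + 1,
    Function.extend φ (φ ∘ par) id, Function.extend φ d 0, ?_, ?_, ?_⟩
  · simp [hφ.extend_apply, d]
  · intro j hj
    have hj' := (Finset.mem_filter.1 hj).2
    simp only [Function.comp_apply, hφ.extend_apply]
    exact ⟨congrArg φ (hpar (hadj j) hj'), hj'⟩
  · intro j hj
    have hj' : d (u j.castSucc) = d (u j.succ) + 1 := by
      rcases hT.dist_eq_dist_add_one_of_adj (u 0) (hadj j) with h | h
      · exact h
      · exact (hj (Finset.mem_filter.2 ⟨Finset.mem_univ j, h⟩)).elim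
    simp only [Function.comp_apply, hφ.extend_apply]
    exact ⟨congrArg φ (hpar (hadj j).symm hj'), hj'⟩

/-- The pairs of kernels that contribute to the sum over kernels. -/
def IsLimitKernel {K : ℕ} (z : Setoid (Fin (K + 1)) × Setoid (Fin (K + 1))) : Prop :=
  (quotGraph z.1 z.2).IsTree ∧ ∀ p ∈ values (quotSteps z.1 z.2), 2 ≤ mult (quotSteps z.1 z.2) p

theorem IsLimitKernel.card_values_le {K : ℕ} {z : Setoid (Fin (K + 1)) × Setoid (Fin (K + 1))}
    (hz : IsLimitKernel z) : (values (quotSteps z.1 z.2)).card ≤ K + 1 := by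
  have h1 := sum_mult_values (quotSteps z.1 z.2)
  have h2 := Finset.sum_le_sum hz.2
  rw [h1] at h2
  simp at h2
  omega

-- A tree with at most `K + 1` edges has at most `K + 2` vertices, so its word can be written in the
-- alphabet `Fin (K + 2)`. Any injective labeling lets the kernels be read back from the word.
open Classical in
theorem card_isLimitKernel_le (K : ℕ) :
    (Finset.univ.filter fun z : Setoid (Fin (K + 1)) × Setoid (Fin (K + 1)) =>
      IsLimitKernel z).card ≤ (K + 2) * (4 ^ (K + 1) * (K + 2) ^ (K + 1)) := by
  have hemb : ∀ z : Setoid (Fin (K + 1)) × Setoid (Fin (K + 1)), IsLimitKernel z →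
      ∃ φ : Quotient z.1 ⊕ Quotient z.2 → Fin (K + 2), Function.Injective φ := by
    intro z hz
    have h1 := hz.card_values_le
    have h2 := (quotGraph_isTree_iff z.1 z.2).1 hz.1
    obtain ⟨φ⟩ := Function.Embedding.nonempty_of_card_le
      (α := Quotient z.1 ⊕ Quotient z.2) (β := Fin (K + 2)) (by
        rw [← Nat.card_eq_fintype_card, Nat.card_sum, Fintype.card_fin]
        omega)
    exact ⟨φ, φ.injective⟩
  choose! φ hφ using hemb
  have h := card_le_of_isTreeWord (L := Fin (K + 2))
    (Finset.univ.filter fun z : Setoid (Fin (K + 1)) × Setoid (Fin (K + 1)) => IsLimitKernel z)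
    (fun z => φ z ∘ quotWord z.1 z.2) ?_ ?_ ?_
  · simpa using h
  · intro z hz z' hz' heq
    have h1 := (Finset.mem_filter.1 hz).2
    have h2 := (Finset.mem_filter.1 hz').2
    have h3 := congrArg kernels heq
    simp only at h3
    rwa [kernels_comp (hφ z h1), kernels_comp (hφ z' h2), kernels_quotWord,
      kernels_quotWord] at h3
  · intro z hz
    have h1 := (Finset.mem_filter.1 hz).2
    exact exists_isTreeWord h1.1 (hφ z h1)
  · intro z _
    exact congrArg (φ z) ((altWord_last _ _).trans (altWord_zero _ _).symm)

/-- The powers of `γ` combine to the total number of steps, and there are at most `K + 1` factors `C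
≥ 1`. -/
theorem abs_multProd_le {K : ℕ} {A : ℕ → ℝ} {C γ : ℝ} (hC : 1 ≤ C) (hγ : 0 < γ)
    (hA : ∀ b, |A b| ≤ C * γ ^ b) {z : Setoid (Fin (K + 1)) × Setoid (Fin (K + 1))}
    (hz : IsLimitKernel z) :
    |multProd A (quotSteps z.1 z.2)| ≤ (C * γ ^ 2) ^ (K + 1) := by
  rw [multProd, Finset.abs_prod]
  refine (Finset.prod_le_prod (fun _ _ => abs_nonneg _) fun p _ => hA _).trans ?_
  rw [Finset.prod_mul_distrib, Finset.prod_const, Finset.prod_pow_eq_pow_sum, sum_mult_values,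
    mul_pow, ← pow_mul]
  have h1 : Fintype.card (Fin (K + 1) × Bool) = 2 * (K + 1) := by simp; ring
  rw [h1]
  gcongr
  exact hz.card_values_le

theorem abs_kernelSum_le {A : ℕ → ℝ} {C γ α : ℝ} (hA1 : A 1 = 0) (hC : 1 ≤ C) (hγ : 0 < γ)
    (hα : 0 < α) (hA : ∀ b, |A b| ≤ C * γ ^ b) (K : ℕ) :
    |kernelSum A α K| ≤ ((K + 2) * (4 ^ (K + 1) * (K + 2) ^ (K + 1)) : ℝ) *
      (max 1 α * (C * γ ^ 2)) ^ (K + 1) := by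
  classical
  rw [kernelSum, ← Fintype.sum_prod_type' (f := fun (π ρ : Setoid (Fin (K + 1))) =>
    (if Nat.card (Quotient π) + Nat.card (Quotient ρ) = (values (quotSteps π ρ)).card + 1
      then α ^ Nat.card (Quotient ρ) else 0) * multProd A (quotSteps π ρ))]
  have hzero : ∀ z : Setoid (Fin (K + 1)) × Setoid (Fin (K + 1)), ¬ IsLimitKernel z →
      (if Nat.card (Quotient z.1) + Nat.card (Quotient z.2) =
          (values (quotSteps z.1 z.2)).card + 1
        then α ^ Nat.card (Quotient z.2) else 0) * multProd A (quotSteps z.1 z.2) = 0 := by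
    intro z hz
    by_cases htree : (quotGraph z.1 z.2).IsTree
    · have hex : ∃ p ∈ values (quotSteps z.1 z.2), mult (quotSteps z.1 z.2) p < 2 := by
        by_contra! hcon
        exact hz ⟨htree, hcon⟩
      obtain ⟨p, hp, hlt⟩ := hex
      have hpos := mult_pos_iff.2 (mem_values.1 hp)
      have h1 : mult (quotSteps z.1 z.2) p = 1 := by omega
      rw [multProd, Finset.prod_eq_zero hp (by rw [h1, hA1]), mul_zero]
    · rw [if_neg (fun h => htree ((quotGraph_isTree_iff z.1 z.2).2 h)), zero_mul]
  rw [← Finset.sum_filter_of_ne (p := IsLimitKernel) (fun z _ hne => by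
    by_contra hz
    exact hne (hzero z hz))]
  refine (Finset.abs_sum_le_sum_abs _ _).trans ?_
  have hterm : ∀ z ∈ Finset.univ.filter
      (fun z : Setoid (Fin (K + 1)) × Setoid (Fin (K + 1)) => IsLimitKernel z),
      |(if Nat.card (Quotient z.1) + Nat.card (Quotient z.2) =
          (values (quotSteps z.1 z.2)).card + 1
        then α ^ Nat.card (Quotient z.2) else 0) * multProd A (quotSteps z.1 z.2)| ≤
      (max 1 α * (C * γ ^ 2)) ^ (K + 1) := by
    intro z hz
    have hz' := (Finset.mem_filter.1 hz).2
    have h2 := (quotGraph_isTree_iff z.1 z.2).1 hz'.1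
    have h3 : 1 ≤ Nat.card (Quotient z.1) := Nat.card_pos
    have h4 := hz'.card_values_le
    rw [if_pos h2, abs_mul, abs_of_pos (by positivity), mul_pow]
    refine mul_le_mul ?_ (abs_multProd_le hC hγ hA hz') (abs_nonneg _) (by positivity)
    calc α ^ Nat.card (Quotient z.2) ≤ (max 1 α) ^ Nat.card (Quotient z.2) := by
          gcongr
          exact le_max_right _ _
      _ ≤ _ := pow_le_pow_right₀ (le_max_left _ _) (by omega)
  refine (Finset.sum_le_card_nsmul _ _ _ hterm).trans ?_
  rw [nsmul_eq_mul]
  gcongr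
  exact_mod_cast card_isLimitKernel_le K

theorem factorialBound_limitMoment {A : ℕ → ℝ} {α : ℝ} (hA1 : A 1 = 0) (hα : 0 < α)
    (hA : ∃ γ : ℝ, 0 < γ ∧ A =O[atTop] (fun k : ℕ => γ ^ k)) :
    FactorialBound (limitMoment A α) := by
  obtain ⟨γ, hγ, hO⟩ := hA
  obtain ⟨C, hC, hb⟩ := Asymptotics.bound_of_isBigO_nat_atTop hO
  have hb' : ∀ b, |A b| ≤ max 1 C * γ ^ b := by
    intro b
    have := hb (x := b) (by positivity)
    rw [Real.norm_eq_abs, Real.norm_of_nonneg (by positivity)] at this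
    refine this.trans ?_
    gcongr
    exact le_max_right _ _
  set B := max 1 α * (max 1 C * γ ^ 2) with hB
  have hB0 : 0 < B := by positivity
  -- From `(K + 2) ^ (K + 2) ≤ exp (K + 2) * (K + 2)!` and `K + 2 ≤ 2 ^ (K + 1)`. The `8` is this
  -- `2` times the `4` of the count of kernels, and `Real.exp 1` takes the one surplus factor of
  -- `exp (K + 2)`.
  refine ⟨Real.exp 1, 8 * Real.exp 1 * B, Real.one_le_exp zero_le_one, by positivity, ?_⟩
  intro k hk
  obtain ⟨K, rfl⟩ := Nat.exists_eq_add_of_le' hk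
  rw [← kernelSum_eq_limitMoment hA1]
  refine (abs_kernelSum_le hA1 (le_max_left _ _) hγ hα hb' K).trans ?_
  rw [← hB]
  have h1 := Real.pow_div_factorial_le_exp ((K : ℝ) + 2) (by positivity) (K + 2)
  rw [div_le_iff₀ (by positivity)] at h1
  have h2 : ((K + 2).factorial : ℝ) ≤ 2 ^ (K + 1) * (K + 1).factorial := by
    have h3 : K + 2 ≤ 2 ^ (K + 1) := Nat.lt_two_pow_self
    have h4 : (K + 2).factorial = (K + 2) * (K + 1).factorial := Nat.factorial_succ (K + 1)
    rw [h4]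
    push_cast
    gcongr
    exact_mod_cast h3
  have h5 : Real.exp ((K : ℝ) + 2) = Real.exp 1 * Real.exp 1 ^ (K + 1) := by
    rw [← Real.exp_nat_mul, ← Real.exp_add]
    congr 1
    push_cast
    ring
  calc ((K + 2) * (4 ^ (K + 1) * (K + 2) ^ (K + 1)) : ℝ) * B ^ (K + 1)
      = ((K : ℝ) + 2) ^ (K + 2) * (4 ^ (K + 1) * B ^ (K + 1)) := by ring
    _ ≤ (Real.exp ((K : ℝ) + 2) * (2 ^ (K + 1) * (K + 1).factorial)) *
          (4 ^ (K + 1) * B ^ (K + 1)) := by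
        gcongr
        exact h1.trans (by gcongr)
    _ = _ := by
        rw [h5, show (8 : ℝ) = 2 * 4 by norm_num]
        simp only [mul_pow]
        ring

/-! ### Convergence of the spectral measures -/

section convergence

variable {Ω : ℕ → Type*} {m : ℕ → ℕ} {v : ℕ → ℝ}
  {X : ∀ n, Ω n → Matrix (Fin n) (Fin (m n)) ℝ} [∀ n, MeasurableSpace (Ω n)]
  {Pr : ∀ n, Measure (Ω n)}

/-- The event that one of the first `N` moments of the spectral measure is not close to its
limit. -/
def badEvent {n m : ℕ} {Ω : Type*} (c : ℕ → ℝ) (v : ℝ) (X : Ω → Matrix (Fin n) (Fin m) ℝ)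
    (N : ℕ) : Set Ω :=
  ⋃ k ∈ Finset.Icc 1 N, {ω | 1 / ((N : ℝ) + 1) ≤
    |mom (spectralMeasure (wishart_isHermitian v (X ω))) k - c k|}

theorem abs_mom_sub_lt_of_notMem_badEvent {n m : ℕ} {Ω : Type*} {c : ℕ → ℝ} {v : ℝ}
    {X : Ω → Matrix (Fin n) (Fin m) ℝ} {N : ℕ} {ω : Ω} (h : ω ∉ badEvent c v X N) (k : ℕ)
    (hk : 1 ≤ k) (hkN : k ≤ N) :
    |mom (spectralMeasure (wishart_isHermitian v (X ω))) k - c k| < 1 / ((N : ℝ) + 1) := by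
  by_contra hcon
  exact h (Set.mem_biUnion (Finset.mem_coe.2 (Finset.mem_Icc.2 ⟨hk, hkN⟩)) (not_lt.1 hcon))

theorem tendsto_measure_badEvent {c : ℕ → ℝ}
    (hc : ∀ k : ℕ, 1 ≤ k → ∀ δ : ℝ, 0 < δ → Tendsto (fun n => Pr n {ω | δ ≤ |mom
      (spectralMeasure (wishart_isHermitian (v n) (X n ω))) k - c k|}) atTop (𝓝 0)) (N : ℕ) :
    Tendsto (fun n => Pr n (badEvent c (v n) (X n) N)) atTop (𝓝 0) := by
  have h := tendsto_finsetSum (Finset.Icc 1 N) fun k hk =>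
    hc k (Finset.mem_Icc.1 hk).1 (1 / ((N : ℝ) + 1)) (by positivity)
  rw [Finset.sum_const_zero] at h
  exact tendsto_of_tendsto_of_tendsto_of_le_of_le tendsto_const_nhds h (fun _ => zero_le)
    fun n => measure_biUnion_finset_le _ _

/-- If the moments of the spectral measures converge in probability, then their limits are the
moments of a probability law. -/
theorem exists_hasMoments [∀ n, IsProbabilityMeasure (Pr n)] {c : ℕ → ℝ}
    (hc : ∀ k : ℕ, 1 ≤ k → ∀ δ : ℝ, 0 < δ → Tendsto (fun n => Pr n {ω | δ ≤ |mom
      (spectralMeasure (wishart_isHermitian (v n) (X n ω))) k - c k|}) atTop (𝓝 0)) :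
    ∃ μ : Measure ℝ, IsProbabilityMeasure μ ∧ HasMoments μ c := by
  have key : ∀ N : ℕ, ∃ ν : ProbabilityMeasure ℝ,
      (∀ k : ℕ, Integrable (fun x : ℝ => x ^ k) (ν : Measure ℝ)) ∧
      ∀ k : ℕ, 1 ≤ k → k ≤ N → |mom ν k - c k| < 1 / ((N : ℝ) + 1) := by
    intro N
    -- An event of probability less than `1` misses some outcome. The spectral measure at that
    -- outcome is a deterministic law whose first `N` moments are close to `c`.
    obtain ⟨n, hlt, hn⟩ := (((tendsto_measure_badEvent hc N).eventually_lt_const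
      (zero_lt_one' ENNReal)).and (eventually_ge_atTop 1)).exists
    obtain ⟨ω, hω⟩ : ∃ ω, ω ∉ badEvent c (v n) (X n) N := by
      by_contra! hcon
      rw [Set.eq_univ_of_forall hcon, measure_univ] at hlt
      exact lt_irrefl _ hlt
    exact ⟨⟨_, isProbabilityMeasure_spectralMeasure hn (wishart_isHermitian (v n) (X n ω))⟩,
      fun k => integrable_spectralMeasure hn _ _, abs_mom_sub_lt_of_notMem_badEvent hω⟩
  choose ν hint hν using key
  obtain ⟨-, μ, -, -, hμ⟩ :=
    exists_subseq_tendsto_of_tendsto_mom hint (tendsto_mom_of_abs_sub_lt hν)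
  exact ⟨μ, inferInstance, hμ⟩

/-- If the moments of the spectral measures converge in probability to those of a law determined
by its moments, then the spectral measures converge weakly in probability to this law. -/
theorem tendsto_measure_abs_integral_sub {c : ℕ → ℝ} (hb : FactorialBound c) {μ : Measure ℝ}
    [IsProbabilityMeasure μ] (hμ : HasMoments μ c)
    (hc : ∀ k : ℕ, 1 ≤ k → ∀ δ : ℝ, 0 < δ → Tendsto (fun n => Pr n {ω | δ ≤ |mom
      (spectralMeasure (wishart_isHermitian (v n) (X n ω))) k - c k|}) atTop (𝓝 0))
    (f : BoundedContinuousFunction ℝ ℝ) {ε : ℝ} (hε : 0 < ε) :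
    Tendsto (fun n => Pr n {ω | ε <
      |∫ x, f x ∂(spectralMeasure (wishart_isHermitian (v n) (X n ω))) - ∫ x, f x ∂μ|})
      atTop (𝓝 0) := by
  obtain ⟨N, hN⟩ := exists_forall_abs_integral_sub_lt hb hμ f hε
  refine tendsto_of_tendsto_of_tendsto_of_le_of_le' tendsto_const_nhds
    (tendsto_measure_badEvent hc N) (Eventually.of_forall fun _ => zero_le) ?_
  filter_upwards [eventually_ge_atTop 1] with n hn
  refine measure_mono fun ω hω => ?_
  by_contra hbad
  exact absurd (hN _ (isProbabilityMeasure_spectralMeasure hn _)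
    (fun k => integrable_spectralMeasure hn _ _) (abs_mom_sub_lt_of_notMem_badEvent hbad))
    (not_le.2 hω)

end convergence

theorem tendsto_measure_abs_mom_sub_limitMoment {A : ℕ → ℝ} {α : ℝ} (hα : 0 < α) (hA1 : A 1 = 0)
    {P : ℕ → Measure ℝ} {m : ℕ → ℕ} {Ω : ℕ → Type*} [∀ n, MeasurableSpace (Ω n)]
    {Pr : ∀ n, Measure (Ω n)} [∀ n, IsProbabilityMeasure (Pr n)]
    {X : ∀ n, Ω n → Matrix (Fin n) (Fin (m n)) ℝ}
    (hP : ∀ n, 1 ≤ n → IsProbabilityMeasure (P n))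
    (hint : ∀ n, 1 ≤ n → ∀ k : ℕ, Integrable (fun x : ℝ => x ^ k) (P n))
    (hv : ∀ n, 1 ≤ n → 0 < mom (P n) 2)
    (hA : ∀ b, 1 ≤ b → Tendsto (fun n => normMom (P n) n b) atTop (𝓝 (A b)))
    (hm : Tendsto (fun n : ℕ => (m n : ℝ) / (n : ℝ)) atTop (𝓝 α))
    (hlaw : ∀ n, 1 ≤ n → ∀ i j, HasLaw (fun ω => X n ω i j) (P n) (Pr n))
    (hind : ∀ n, 1 ≤ n →
      iIndepFun (fun (p : Fin n × Fin (m n)) (ω : Ω n) => X n ω p.1 p.2) (Pr n))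
    (k : ℕ) (hk : 1 ≤ k) (δ : ℝ) (hδ : 0 < δ) :
    Tendsto (fun n => Pr n {ω | δ ≤ |mom (spectralMeasure
      (wishart_isHermitian (mom (P n) 2) (X n ω))) k - limitMoment A α k|}) atTop (𝓝 0) := by
  obtain ⟨K, rfl⟩ := Nat.exists_eq_add_of_le' hk
  rw [← kernelSum_eq_limitMoment hA1]
  exact tendsto_measure_abs_mom_sub hα hP hint hv hA hm hlaw hind K hδ

theorem eq_zero_of_tendsto_normMom {A : ℕ → ℝ} {P : ℕ → Measure ℝ}
    (h1 : ∀ n, 1 ≤ n → mom (P n) 1 = 0)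
    (hA : Tendsto (fun n => normMom (P n) n 1) atTop (𝓝 (A 1))) : A 1 = 0 := by
  refine tendsto_nhds_unique hA (tendsto_const_nhds.congr' ?_)
  filter_upwards [eventually_ge_atTop 1] with n hn
  rw [normMom, h1 n hn, zero_div]

end Wishart

end

theorem theorem1 (A : ℕ → ℝ) (α : ℝ) (hα : 0 < α)
    (hA : ∃ γ : ℝ, 0 < γ ∧ A =O[atTop] (fun k : ℕ => γ ^ k)) :
    ∃ μ : Measure ℝ, IsProbabilityMeasure μ ∧
      ∀ (P : ℕ → Measure ℝ) (m : ℕ → ℕ)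
        (Ω : ℕ → Type*) [∀ n, MeasurableSpace (Ω n)]
        (Pr : ∀ n, Measure (Ω n)) [∀ n, IsProbabilityMeasure (Pr n)]
        (X : ∀ n, Ω n → Matrix (Fin n) (Fin (m n)) ℝ),
        -- the laws `P n`, `n ≥ 1`: centered, non-degenerate, with finite moments
        (∀ n, 1 ≤ n → IsProbabilityMeasure (P n)) →
        (∀ n, 1 ≤ n → ∀ k : ℕ, Integrable (fun x : ℝ => x ^ k) (P n)) →
        (∀ n, 1 ≤ n → Wishart.mom (P n) 1 = 0) →
        (∀ n, 1 ≤ n → 0 < Wishart.mom (P n) 2) →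
        -- the normalized moments converge to the sequence `A`
        (∀ k : ℕ, 1 ≤ k → Tendsto
          (fun n : ℕ => Wishart.mom (P n) k /
            ((n : ℝ) ^ ((k : ℝ) / 2 - 1) * Wishart.mom (P n) 2 ^ ((k : ℝ) / 2)))
          atTop (𝓝 (A k))) →
        -- the ratio of the dimensions converges to `α`
        Tendsto (fun n : ℕ => (m n : ℝ) / (n : ℝ)) atTop (𝓝 α) →
        -- the entries of `X n` are i.i.d. with law `P n`
        (∀ n, 1 ≤ n → ∀ i j, HasLaw (fun ω => X n ω i j) (P n) (Pr n)) →
        (∀ n, 1 ≤ n →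
          iIndepFun (fun (p : Fin n × Fin (m n)) (ω : Ω n) => X n ω p.1 p.2) (Pr n)) →
        -- weak convergence in probability of the spectral measures
        (∀ ε : ℝ, 0 < ε → ∀ f : BoundedContinuousFunction ℝ ℝ, Tendsto
          (fun n : ℕ => Pr n {ω | ε <
            |∫ x, f x ∂(Wishart.spectralMeasure
                (Wishart.wishart_isHermitian (Wishart.mom (P n) 2) (X n ω)))
              - ∫ x, f x ∂μ|})
          atTop (𝓝 0)) ∧
        -- the moments of the limit
        (∀ k : ℕ, 1 ≤ k → Integrable (fun x : ℝ => x ^ k) μ ∧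
          Wishart.mom μ k = Wishart.limitMoment A α k) ∧
        -- the limit is characterized by its moments
        (∀ ν : Measure ℝ, IsProbabilityMeasure ν →
          (∀ k : ℕ, 1 ≤ k → Integrable (fun x : ℝ => x ^ k) ν ∧
            Wishart.mom ν k = Wishart.limitMoment A α k) →
          ν = μ) := by
  -- The law has to be chosen from `A` and `α` alone, before any `P n` is given, whereas its
  -- existence is derived from the matrices. Likewise `A 1 = 0`, and with it the factorial bound, is
  -- known only once the laws `P n` are introduced.
  by_cases hex : ∃ μ : Measure ℝ, IsProbabilityMeasure μ ∧
      Wishart.HasMoments μ (Wishart.limitMoment A α)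
  · obtain ⟨μ, hμ, hmom⟩ := hex
    refine ⟨μ, hμ, ?_⟩
    intro P m Ω _ Pr _ X hP hint h1 hv hlim hm hlaw hind
    have hA1 : A 1 = 0 := Wishart.eq_zero_of_tendsto_normMom h1 (hlim 1 le_rfl)
    have hb := Wishart.factorialBound_limitMoment hA1 hα hA
    exact ⟨fun ε hε f => Wishart.tendsto_measure_abs_integral_sub hb hmom
      (Wishart.tendsto_measure_abs_mom_sub_limitMoment hα hA1 hP hint hv hlim hm hlaw hind) f hε,
      hmom, fun ν _ hν => Wishart.eq_of_hasMoments hb hν hmom⟩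
  · -- there are no laws `P n` as in the statement
    refine ⟨Measure.dirac 0, inferInstance, ?_⟩
    intro P m Ω _ Pr _ X hP hint h1 hv hlim hm hlaw hind
    have hA1 : A 1 = 0 := Wishart.eq_zero_of_tendsto_normMom h1 (hlim 1 le_rfl)
    exact absurd (Wishart.exists_hasMoments
      (Wishart.tendsto_measure_abs_mom_sub_limitMoment hα hA1 hP hint hv hlim hm hlaw hind)) hex
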